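/- Let $N\ge 2$, $\lambda_c,\lambda_r\ge 0$, and consider the following open system of $N$ agents, started at time $0$ (the Gossip model). Each agent $i$ is replaced at the ticks of a Poisson clock of rate $\lambda_r$; each unordered pair of distinct agents interacts at the ticks of a Poisson clock of rate $\lambda_c/(N-1)$; initially and at each replacement of $i$, agent $i$ receives a new value, which it holds until its next replacement; let $x_i(t)$ denote the value held by $i$ at time $t$. All values are i.i.d., centred, with finite variance $\sigma^2$, and all clocks are independent of each other and of the values. The knowledge set of agent $i$ is reset to $\{(x_i(t_0),i,t_0)\}$ at each arrival time $t_0$ of $i$ (at time $0$ and at each replacement); when $i$ and $j$ interact at time $\tau$, agent $i$ adds to its knowledge set that of $j$ just before $\tau$, the triple $(x_j(\tau),j,\tau)$, and a record of the exchange, and simultaneously $j$ does the same with the roles exchanged. A triple $(x_j(\tau),j,\tau)$ is called an information about $j$ of time $\tau$. For $j\ne i$ and $t\ge 0$, let $T(t)$ be the smallest $s$ such that $(x_j(t-s),j,t-s)$ belongs to the knowledge set of $i$ at time $t$, with $T(t)=\infty$ if there is no such $s$ (the age of the most recent information about $j$ held by $i$), and let $F(s)=P[T(t)\le s]$ be its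 pseudo-CDF. (1) For all $j\neq i$ and $t\ge 0$, $T(t)$ has on $[0,t]$ the pseudo-PDF $$f(s)=w^{T}Ae^{As}\mathbf e_1,$$ which does not depend on $i,j,t$, and no mass beyond $t$; that is, $F(s)=\int_0^{\min(s,t)}f(r)\,dr$ for all $s\ge 0$, and $F'(s)=f(s)$ for $s\in[0,t]$ (one-sided at the end points, for $t>0$). Here $w\in\mathbb R^N$ has entries $w_k=\frac{k-1}{N-1}$, $\mathbf e_1$ is the first canonical basis vector, and $A\in\mathbb R^{N\times N}$ is the tridiagonal matrix with $$A_{k,k}=-\Big(\tfrac{k(N-k)}{N-1}\lambda_c+(k-1)\lambda_r\Big),\qquad A_{k,k+1}=k\lambda_r,\qquad A_{k+1,k}=\tfrac{k(N-k)}{N-1}\lambda_c .$$ (2) For every agent $j$ and every $t'\ge 0$, let $n_j(t,t')$ be the number of agents holding at time $t\ge t'$ an information about $j$ more recent than $t'$ (an information of time $\tau>t'$), where agent $j$, which always knows its own current value, is counted. Then $u\mapsto n_j(t'+u,t')$, $u\ge 0$, is a continuous-time birth–death Markov chain on $\{1,\dots,N\}$ started at $1$, with almost surely right-continuous paths with left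 limits, with birth rate $\frac{k(N-k)}{N-1}\lambda_c$ and death rate $(k-1)\lambda_r$ in state $k$. -/

import Mathlib

open MeasureTheory ProbabilityTheory Set Filter Topology
open scoped NNReal

/-! ### Sequences of events and knowledge sets -/

/-- A piece of information: either "the value of agent `j` at time `t` is `x`", or
"an information exchange from `j` to `i` happened at time `t`". -/
inductive GossipInfo (N : ℕ) : Type
  | value (x : ℝ) (j : Fin N) (t : ℝ) : GossipInfo N
  | exchange (j i : Fin N) (t : ℝ) : GossipInfo N

/-- A (deterministic) sequence of events in a system of `N` agents observed from time `0` on: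
the replacement times of each agent, the times of the information exchanges from `j` to `i`
(`exch j i`), and the value `x i t` held by agent `i` at time `t`. -/
structure EventSequence (N : ℕ) where
  repl : Fin N → Set ℝ
  exch : Fin N → Fin N → Set ℝ
  x : Fin N → ℝ → ℝ

/-- `Knows ε i t I`: the information `I` belongs to the knowledge set of agent `i` at time `t`
(at an event time: right after the event).

* Upon arrival (at time `0`, or at a replacement of `i`) the knowledge set of `i` is reduced to the
  information of its own value; everything else is erased, since information is carried over a
  time interval only if `i` is not replaced in it.
* At an exchange from `j` to `i` at time `τ`, agent `i` keeps what it knew and receives all that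
  `j` knew just before `τ`, the value of `j` at time `τ`, and a record of the exchange. -/
inductive Knows {N : ℕ} (ε : EventSequence N) : Fin N → ℝ → GossipInfo N → Prop
  | start (i : Fin N) : Knows ε i 0 (.value (ε.x i 0) i 0)
  | arrival (i : Fin N) (t : ℝ) (ht : t ∈ ε.repl i) :
      Knows ε i t (.value (ε.x i t) i t)
  | keep (i : Fin N) (s t : ℝ) (I : GossipInfo N) (hI : Knows ε i s I) (hst : s ≤ t)
      (hr : ∀ r ∈ Ioc s t, r ∉ ε.repl i) : Knows ε i t I
  | receive (j i : Fin N) (s τ : ℝ) (I : GossipInfo N) (hτ : τ ∈ ε.exch j i)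
      (hI : Knows ε j s I) (hs : s < τ) (hr : ∀ r ∈ Ioo s τ, r ∉ ε.repl j) : Knows ε i τ I
  | direct (j i : Fin N) (τ : ℝ) (hτ : τ ∈ ε.exch j i) :
      Knows ε i τ (.value (ε.x j τ) j τ)
  | record (j i : Fin N) (τ : ℝ) (hτ : τ ∈ ε.exch j i) :
      Knows ε i τ (.exchange j i τ)

/-- The knowledge set of agent `i` at time `t`. -/
def knowledgeSet {N : ℕ} (ε : EventSequence N) (i : Fin N) (t : ℝ) : Set (GossipInfo N) :=
  {I | Knows ε i t I}

/-- The age of the most recent information about agent `j` available to agent `i` at time `t`: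
the least `s` such that `(x_j(t-s), j, t-s)` belongs to the knowledge set of `i` at time `t`,
and `⊤` if there is no information about `j` in that knowledge set. -/
noncomputable def ageOfInfo {N : ℕ} (ε : EventSequence N) (j i : Fin N) (t : ℝ) : EReal :=
  sInf ((fun s : ℝ => (s : EReal)) ''
    {s : ℝ | GossipInfo.value (ε.x j (t - s)) j (t - s) ∈ knowledgeSet ε i t})

/-- The number of agents holding, at time `t`, an information about `j` more recent than `t'`.
Agent `j` itself, which always knows its own current value, is counted. -/
noncomputable def numInformed {N : ℕ} (ε : EventSequence N) (j : Fin N) (t t' : ℝ) : ℕ :=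
  {i : Fin N | i = j ∨ ∃ τ : ℝ, t' < τ ∧
    GossipInfo.value (ε.x j τ) j τ ∈ knowledgeSet ε i t}.ncard

/-! ### Poisson clocks -/

/-- The number of points in `(a, b]` of a random set of times. -/
noncomputable def tickCount {Ω : Type*} (S : Ω → Set ℝ) (a b : ℝ) (ω : Ω) : ℕ :=
  (S ω ∩ Ioc a b).ncard

/-- The random set of times `S` is a Poisson clock of rate `r` on `(0, ∞)`: it is locally finite,
the number of points in `(a, b]` is Poisson distributed with parameter `r * (b - a)`, and the
numbers of points in successive intervals are independent. -/
structure IsPoissonClock {Ω : Type*} [MeasurableSpace Ω] (μ : Measure Ω) (S : Ω → Set ℝ)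
    (r : ℝ≥0) : Prop where
  pos : ∀ ω, S ω ⊆ Ioi 0
  locallyFinite : ∀ ω t, (S ω ∩ Iic t).Finite
  measurable_count : ∀ a b, Measurable (tickCount S a b)
  law : ∀ a b, 0 ≤ a → a ≤ b →
    μ.map (tickCount S a b) = poissonMeasure (r * (b - a).toNNReal)
  indep : ∀ u : ℕ → ℝ, 0 ≤ u 0 → Monotone u →
    iIndepFun (fun n => tickCount S (u n) (u (n + 1))) μ

/-- The σ-algebra generated by a random set of times. -/
@[reducible] noncomputable def clockSigma {Ω : Type*} (S : Ω → Set ℝ) : MeasurableSpace Ω :=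
  ⨆ (a : ℝ) (b : ℝ), MeasurableSpace.comap (tickCount S a b) inferInstance

/-! ### The Gossip model -/

/-- The clocks of the Gossip model: one per agent for its replacements, one per unordered pair of
distinct agents for their interactions. -/
inductive GossipClock (N : ℕ) : Type
  | repl (i : Fin N) : GossipClock N
  | pair (e : {e : Sym2 (Fin N) // ¬ e.IsDiag}) : GossipClock N

/-- Individual replacements occur at rate `lamR`, and the interactions of each pair of distinct
agents at rate `lamC / (N - 1)`. -/
noncomputable def GossipClock.rate {N : ℕ} (lamC lamR : ℝ≥0) : GossipClock N → ℝ≥0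
  | .repl _ => lamR
  | .pair _ => lamC / ((N - 1 : ℕ) : ℝ≥0)

/-- A realization of the open system of `N` agents with the Gossip model on the probability space
`(Ω, μ)`. Here `val i m` is the value held by agent `i` after its `m`-th replacement (its initial
value if `m = 0`). The values are i.i.d., centred with variance `sigma ^ 2`; the clocks are Poisson
clocks, and they are independent of each other and of the values. -/
structure GossipModel {Ω : Type*} [MeasurableSpace Ω] (μ : Measure Ω) (N : ℕ) (lamC lamR : ℝ≥0)
    (sigma : ℝ) where
  ticks : GossipClock N → Ω → Set ℝ
  val : Fin N → ℕ → Ω → ℝ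
  poisson : ∀ c, IsPoissonClock μ (ticks c) (c.rate lamC lamR)
  val_measurable : ∀ i m, Measurable (val i m)
  val_indep : iIndepFun (fun p : Fin N × ℕ => val p.1 p.2) μ
  val_identDistrib : ∀ i m i' m', IdentDistrib (val i m) (val i' m') μ μ
  val_memLp : ∀ i m, MemLp (val i m) 2 μ
  val_mean : ∀ i m, ∫ ω, val i m ω ∂μ = 0
  val_variance : ∀ i m, ∫ ω, (val i m ω) ^ 2 ∂μ = sigma ^ 2
  indep : iIndep (fun o : Option (GossipClock N) =>
    o.elim (⨆ p : Fin N × ℕ, MeasurableSpace.comap (val p.1 p.2) inferInstance)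
      (fun c => clockSigma (ticks c))) μ

namespace GossipModel

variable {Ω : Type*} [MeasurableSpace Ω] {μ : Measure Ω} {N : ℕ} {lamC lamR : ℝ≥0} {sigma : ℝ}

/-- The random sequence of events of the Gossip model: whenever the clock of the pair `{i, j}`
ticks, the exchanges from `j` to `i` and from `i` to `j` happen simultaneously. -/
noncomputable def events (G : GossipModel μ N lamC lamR sigma) (ω : Ω) : EventSequence N where
  repl i := G.ticks (.repl i) ω
  exch j i := {τ | ∃ e : {e : Sym2 (Fin N) // ¬ e.IsDiag},
    e.1 = s(j, i) ∧ τ ∈ G.ticks (.pair e) ω}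
  x i t := G.val i (tickCount (G.ticks (.repl i)) 0 t ω) ω

/-- The pseudo-CDF of the age of the most recent information about `j` held by `i` at time `t`. -/
noncomputable def pseudoCDF (G : GossipModel μ N lamC lamR sigma) (j i : Fin N) (t s : ℝ) : ℝ :=
  μ.real {ω | ageOfInfo (G.events ω) j i t ≤ (s : EReal)}

end GossipModel

/-! ### The matrix `A`, the vectors `w` and `e₁`, and birth–death chains

The index `k : Fin N` stands for the state `k + 1` in `{1, …, N}`. -/

/-- Birth rate in state `k`. -/
noncomputable def gossipBirth (N : ℕ) (lamC : ℝ≥0) (k : ℕ) : ℝ :=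
  (k : ℝ) * ((N : ℝ) - k) / ((N : ℝ) - 1) * lamC

/-- Death rate in state `k`. -/
noncomputable def gossipDeath (lamR : ℝ≥0) (k : ℕ) : ℝ :=
  ((k : ℝ) - 1) * lamR

/-- The tridiagonal matrix `A` with `A k k = -(k (N - k) / (N - 1) * lamC + (k - 1) * lamR)`,
`A k (k + 1) = k * lamR` and `A (k + 1) k = k (N - k) / (N - 1) * lamC` (indices from `1`). -/
noncomputable def gossipA (N : ℕ) (lamC lamR : ℝ≥0) : Matrix (Fin N) (Fin N) ℝ :=
  Matrix.of fun r c =>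
    if r = c then
      -(((r : ℝ) + 1) * ((N : ℝ) - ((r : ℝ) + 1)) / ((N : ℝ) - 1) * lamC
        + (((r : ℝ) + 1) - 1) * lamR)
    else if (c : ℕ) = r + 1 then ((r : ℝ) + 1) * lamR
    else if (r : ℕ) = c + 1 then
      ((c : ℝ) + 1) * ((N : ℝ) - ((c : ℝ) + 1)) / ((N : ℝ) - 1) * lamC
    else 0

/-- The vector `w` with `w k = (k - 1) / (N - 1)` (indices from `1`). -/
noncomputable def gossipW (N : ℕ) : Fin N → ℝ :=
  fun k => (((k : ℝ) + 1) - 1) / ((N : ℝ) - 1)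

/-- The first vector of the canonical basis. -/
def gossipE1 (N : ℕ) : Fin N → ℝ :=
  fun k => if (k : ℕ) = 0 then 1 else 0

/-- The function `s ↦ wᵀ A e^{A s} e₁`. -/
noncomputable def gossipDensity (N : ℕ) (lamC lamR : ℝ≥0) (s : ℝ) : ℝ :=
  gossipW N ⬝ᵥ
    ((gossipA N lamC lamR * NormedSpace.exp (s • gossipA N lamC lamR)).mulVec (gossipE1 N))

/-- The generator of the birth–death chain on `{1, …, N}` with birth rates `b` and death rates `d`;
the entry in row `r` and column `c` is the rate of the jumps from state `c + 1` to `r + 1`. -/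
noncomputable def birthDeathGenerator (N : ℕ) (b d : ℕ → ℝ) : Matrix (Fin N) (Fin N) ℝ :=
  Matrix.of fun r c =>
    if (r : ℕ) = c + 1 then b (c + 1)
    else if (c : ℕ) = r + 1 then d (c + 1)
    else if r = c then -(b (c + 1) + d (c + 1))
    else 0

/-- `X` is, in the time `u ≥ 0`, a continuous-time birth–death Markov chain on `{1, …, N}` started
at `x₀` with birth rates `b` and death rates `d`: its paths are almost surely right-continuous with
left limits, and its finite-dimensional distributions are those of the Markov chain with transition
matrices `e^{u Q}`, where `Q` is the generator. -/
structure IsBirthDeathChain {Ω : Type*} [MeasurableSpace Ω] (μ : Measure Ω) (X : ℝ → Ω → ℕ)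
    (N x₀ : ℕ) (b d : ℕ → ℝ) : Prop where
  aemeasurable : ∀ u, 0 ≤ u → AEMeasurable (X u) μ
  rightContinuous : ∀ᵐ ω ∂μ, ∀ u, 0 ≤ u → ContinuousWithinAt (fun v => X v ω) (Ici u) u
  leftLimits : ∀ᵐ ω ∂μ, ∀ u, 0 < u → ∃ k : ℕ, Tendsto (fun v => X v ω) (𝓝[<] u) (𝓝 k)
  finiteDim : ∀ (m : ℕ) (u : ℕ → ℝ), u 0 = 0 → Monotone u → ∀ k : ℕ → Fin N,
    μ.real {ω | ∀ l ≤ m, X (u l) ω = k l + 1} =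
      (if (k 0 : ℕ) + 1 = x₀ then 1 else 0) *
        ∏ l ∈ Finset.range m,
          NormedSpace.exp ((u (l + 1) - u l) • birthDeathGenerator N b d) (k (l + 1)) (k l)

/-! ### Evolution of the knowledge sets -/

section Deterministic

variable {N : ℕ} {ε : EventSequence N}

/-! Fix `j` and `t'`, and call an agent informed if it is `j` or holds an information about `j` more
recent than `t'`. The set of informed agents changes only at ticks: a replacement of `i ≠ j` removes
`i`, and an interaction with an informed agent informs both members of the pair. With `k` informed
agents there are `k (N - k)` pairs that raise the count, each at rate `lamC / (N - 1)`, and `k - 1`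
replacements that lower it, each at rate `lamR`. These rates depend on the set only through `k`, so
the count is a birth–death chain.

To obtain its law from Poisson counts alone, time is cut into short intervals, and a discrete chain
`countChain` moves only in intervals that contain exactly one tick. For a step of length `h` and
total rate `R`, the law of the count is multiplied exactly by `1 + h e^{-Rh} Q`, where `Q` is the
birth–death generator (`integral_cardIndicator_succ`); the `n`-th power of this matrix with `h = s /
n` tends to `e^{sQ}` (`tendsto_euler_exp`). The discrete chain agrees with the true set unless some
interval has two ticks (`informedSet_eq_countChain`), which has probability `O(1/n)`
(`real_meshFailure_le`).

For the age, permutations of the agents fixing `j` preserve the dynamics, so an agent `i ≠ j` is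
informed with probability `E[k - 1] / (N - 1)`, that is `wᵀ e^{As} e₁` when `t' = t - s`
(`real_mem_informedSet`). Being informed since `t - s` lies between "age `< s`" and "age `≤ s`", and
continuity in `s` identifies the pseudo-CDF (`pseudoCDF_eq`); its derivative is the density. -/

lemma Knows.infoTime_le {i : Fin N} {t : ℝ} {I : GossipInfo N} (h : Knows ε i t I) :
    ∀ {x j τ}, I = .value x j τ → τ ≤ t := by
  induction h with
  | start i => rintro x j τ ⟨⟩; exact le_rfl
  | arrival i t ht => rintro x j τ ⟨⟩; exact le_rfl
  | keep i s t I hI hst _ ih => exact fun hx => (ih hx).trans hst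
  | receive j i s τ I hτ hI hs _ ih => exact fun hx => (ih hx).trans hs.le
  | direct j i τ hτ => rintro x j τ ⟨⟩; exact le_rfl
  | record j i τ hτ => rintro x j τ ⟨⟩

/-- Every information about another agent comes with one that was obtained after time `0`. -/
lemma Knows.exists_pos (he : ∀ i k, ε.exch i k ⊆ Ioi 0) {j i : Fin N} {t : ℝ} {I : GossipInfo N}
    (h : Knows ε i t I) : i ≠ j → ∀ {x τ}, I = .value x j τ →
      ∃ τ', 0 < τ' ∧ Knows ε i t (.value (ε.x j τ') j τ') := by
  induction h with
  | start i => rintro hij x τ ⟨⟩; exact absurd rfl hij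
  | arrival i t ht => rintro hij x τ ⟨⟩; exact absurd rfl hij
  | keep i s t I hI hst hr ih =>
    intro hij x τ hx
    obtain ⟨τ', h0, hk⟩ := ih hij hx
    exact ⟨τ', h0, .keep i s t _ hk hst hr⟩
  | receive k i s τ I hτ hI hs hr ih =>
    intro hij x τ₀ hx
    -- If the sender is `j`, the transmitted information may date from time `0`, but the same
    -- exchange also delivers the value of `j` at `τ > 0`.
    by_cases hkj : k = j
    · subst hkj
      exact ⟨τ, he _ i hτ, .direct _ i τ hτ⟩
    · obtain ⟨τ', h0, hk⟩ := ih hkj hx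
      exact ⟨τ', h0, .receive k i s τ _ hτ hk hs hr⟩
  | direct k i τ hτ => rintro hij x τ₀ ⟨⟩; exact ⟨τ, he _ i hτ, .direct _ i τ hτ⟩
  | record k i τ hτ => rintro hij x τ ⟨⟩

/-- Without an event concerning agent `i` in `(a, t]`, what `i` knows at `t` it knew at `a`. -/
lemma Knows.of_later {i : Fin N} {t : ℝ} {I : GossipInfo N} (h : Knows ε i t I) :
    ∀ {a : ℝ}, 0 ≤ a → a ≤ t → (∀ r ∈ Ioc a t, r ∉ ε.repl i) →
      (∀ r ∈ Ioc a t, ∀ k, r ∉ ε.exch k i) → Knows ε i a I := by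
  induction h with
  | start i =>
    intro a h0 ha _ _
    obtain rfl := le_antisymm ha h0
    exact .start i
  | arrival i t ht =>
    intro a h0 ha hr _
    rcases ha.eq_or_lt with rfl | hlt
    · exact .arrival i a ht
    · exact absurd ht (hr t ⟨hlt, le_rfl⟩)
  | keep i s t I hI hst hr' ih =>
    intro a h0 ha hr he
    rcases le_total a s with has | hsa
    · exact ih h0 has (fun r h => hr r ⟨h.1, h.2.trans hst⟩) (fun r h => he r ⟨h.1, h.2.trans hst⟩)
    · exact .keep i s a I hI hsa (fun r h => hr' r ⟨h.1, h.2.trans ha⟩)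
  | receive k i s τ I hτ hI hs hr' ih =>
    intro a h0 ha hr he
    rcases ha.eq_or_lt with rfl | hlt
    · exact .receive k i s a I hτ hI hs hr'
    · exact absurd hτ (he τ ⟨hlt, le_rfl⟩ k)
  | direct k i τ hτ =>
    intro a h0 ha hr he
    rcases ha.eq_or_lt with rfl | hlt
    · exact .direct k i a hτ
    · exact absurd hτ (he τ ⟨hlt, le_rfl⟩ k)
  | record k i τ hτ =>
    intro a h0 ha hr he
    rcases ha.eq_or_lt with rfl | hlt
    · exact .record k i a hτ
    · exact absurd hτ (he τ ⟨hlt, le_rfl⟩ k)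

/-- What is known just after an event time `τ` in terms of what was known at a time `a` such that
no event happens in `(a, τ)`. -/
lemma Knows.cases_at {i : Fin N} {τ : ℝ} {I : GossipInfo N} (h : Knows ε i τ I) :
    ∀ {a : ℝ}, 0 ≤ a → a < τ → (∀ i, ∀ r ∈ Ioo a τ, r ∉ ε.repl i) →
      (∀ i k, ∀ r ∈ Ioo a τ, r ∉ ε.exch k i) →
      (τ ∉ ε.repl i ∧ Knows ε i a I) ∨ (τ ∈ ε.repl i ∧ I = .value (ε.x i τ) i τ) ∨
      ∃ k, τ ∈ ε.exch k i ∧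
        (Knows ε k a I ∨ I = .value (ε.x k τ) k τ ∨ I = .exchange k i τ) := by
  -- What is held at some `s < τ` and not erased before `τ` is already held at `a`: go back along
  -- the quiet interval if `a ≤ s`, keep it from `s` to `a` otherwise.
  have back : ∀ {i s I} {a τ : ℝ}, Knows ε i s I → 0 ≤ a → a < τ →
      (∀ i, ∀ r ∈ Ioo a τ, r ∉ ε.repl i) → (∀ i k, ∀ r ∈ Ioo a τ, r ∉ ε.exch k i) → s < τ →
      (∀ r ∈ Ioo s τ, r ∉ ε.repl i) → Knows ε i a I := by
    intro i s I a τ hI h0 ha hr he hs hrs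
    rcases le_total a s with has | hsa
    · exact hI.of_later h0 has (fun r h => hr i r ⟨h.1, h.2.trans_lt hs⟩)
        (fun r h k => he i k r ⟨h.1, h.2.trans_lt hs⟩)
    · exact .keep i s a I hI hsa (fun r h => hrs r ⟨h.1, h.2.trans_lt ha⟩)
  induction h with
  | start i => intro a h0 ha; exact absurd ha (not_lt.2 h0)
  | arrival i t ht => exact fun _ _ _ _ => Or.inr (Or.inl ⟨ht, rfl⟩)
  | keep i s t I hI hst hr' ih =>
    intro a h0 ha hr he
    rcases hst.eq_or_lt with rfl | hs
    · exact ih h0 ha hr he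
    · exact Or.inl ⟨hr' t ⟨hs, le_rfl⟩,
        back hI h0 ha hr he hs (fun r h => hr' r ⟨h.1, h.2.le⟩)⟩
  | receive k i s τ I hτ hI hs hr' ih =>
    intro a h0 ha hr he
    exact Or.inr (Or.inr ⟨k, hτ, Or.inl (back hI h0 ha hr he hs hr')⟩)
  | direct k i τ hτ => exact fun _ _ _ _ => Or.inr (Or.inr ⟨k, hτ, Or.inr (Or.inl rfl)⟩)
  | record k i τ hτ => exact fun _ _ _ _ => Or.inr (Or.inr ⟨k, hτ, Or.inr (Or.inr rfl)⟩)

/-- Agent `i` holds at time `t` an information about `j` more recent than `t'`, or is `j`. -/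
def Informed (ε : EventSequence N) (j : Fin N) (t' t : ℝ) (i : Fin N) : Prop :=
  i = j ∨ ∃ τ : ℝ, t' < τ ∧ Knows ε i t (.value (ε.x j τ) j τ)

lemma informed_self_iff {j i : Fin N} {t : ℝ} : Informed ε j t t i ↔ i = j := by
  refine ⟨?_, Or.inl⟩
  rintro (h | ⟨τ, hτ, h⟩)
  · exact h
  · exact absurd (h.infoTime_le rfl) (not_le.2 hτ)

lemma informed_iff_of_no_event {j i : Fin N} {t' a b : ℝ} (h0 : 0 ≤ a) (hab : a ≤ b)
    (hr : ∀ i, ∀ r ∈ Ioc a b, r ∉ ε.repl i) (he : ∀ i k, ∀ r ∈ Ioc a b, r ∉ ε.exch k i) :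
    Informed ε j t' b i ↔ Informed ε j t' a i := by
  refine or_congr Iff.rfl (exists_congr fun τ => and_congr Iff.rfl ⟨fun h => ?_, fun h => ?_⟩)
  · exact h.of_later h0 hab (hr i) (fun r h k => he i k r h)
  · exact .keep i a b _ h hab (hr i)

/-- The replaced agent loses everything but its own value, which concerns `j` only when `i₀ = j`;
that case is absorbed by the convention that `j` is always informed. -/
lemma informed_iff_of_repl {j i i₀ : Fin N} {t' a τ : ℝ} (h0 : 0 ≤ a) (haτ : a < τ)
    (hr : ∀ i, ∀ r ∈ Ioo a τ, r ∉ ε.repl i) (he : ∀ i k, ∀ r ∈ Ioo a τ, r ∉ ε.exch k i)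
    (hτ : ∀ i, τ ∈ ε.repl i ↔ i = i₀) (hτe : ∀ i k, τ ∉ ε.exch k i) :
    Informed ε j t' τ i ↔ i = j ∨ (i ≠ i₀ ∧ Informed ε j t' a i) := by
  constructor
  · rintro (h | ⟨τ₀, h1, h⟩)
    · exact Or.inl h
    rcases h.cases_at h0 haτ hr he with ⟨h2, h3⟩ | ⟨h2, h3⟩ | ⟨k, h2, -⟩
    · exact Or.inr ⟨fun h => h2 ((hτ i).2 h), Or.inr ⟨τ₀, h1, h3⟩⟩
    · simp only [GossipInfo.value.injEq] at h3
      exact Or.inl h3.2.1.symm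
    · exact absurd h2 (hτe i k)
  · rintro (h | ⟨hi, h | ⟨τ₀, h1, h⟩⟩)
    · exact Or.inl h
    · exact Or.inl h
    · refine Or.inr ⟨τ₀, h1, .keep i a τ _ h haτ.le fun r hr' hri => ?_⟩
      rcases hr'.2.eq_or_lt with rfl | hlt
      · exact hi ((hτ i).1 hri)
      · exact hr i r ⟨hr'.1, hlt⟩ hri

lemma informed_iff_of_exch {j i : Fin N} {e : Sym2 (Fin N)} {t' a τ : ℝ} (h0 : 0 ≤ a)
    (ht' : t' ≤ a) (haτ : a < τ)
    (hr : ∀ i, ∀ r ∈ Ioo a τ, r ∉ ε.repl i) (he : ∀ i k, ∀ r ∈ Ioo a τ, r ∉ ε.exch k i)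
    (hτ : ∀ i, τ ∉ ε.repl i) (hτe : ∀ i k, τ ∈ ε.exch k i ↔ e = s(k, i)) :
    Informed ε j t' τ i ↔
      Informed ε j t' a i ∨ (i ∈ e ∧ ∃ k ∈ e, Informed ε j t' a k) := by
  constructor
  · rintro (h | ⟨τ₀, h1, h⟩)
    · exact Or.inl (Or.inl h)
    rcases h.cases_at h0 haτ hr he with ⟨-, h3⟩ | ⟨h2, -⟩ | ⟨k, h2, h3⟩
    · exact Or.inl (Or.inr ⟨τ₀, h1, h3⟩)
    · exact absurd h2 (hτ i)
    · rw [hτe] at h2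
      subst h2
      refine Or.inr ⟨Sym2.mem_mk_right _ _, k, Sym2.mem_mk_left _ _, ?_⟩
      rcases h3 with h3 | h3 | h3
      · exact Or.inr ⟨τ₀, h1, h3⟩
      · simp only [GossipInfo.value.injEq] at h3
        exact Or.inl h3.2.1.symm
      · cases h3
  · have keep : Informed ε j t' a i → Informed ε j t' τ i := by
      rintro (h | ⟨τ₀, h1, h⟩)
      · exact Or.inl h
      · refine Or.inr ⟨τ₀, h1, .keep i a τ _ h haτ.le fun r hr' hri => ?_⟩
        rcases hr'.2.eq_or_lt with rfl | hlt
        · exact hτ i hri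
        · exact hr i r ⟨hr'.1, hlt⟩ hri
    rintro (h | ⟨hi, k, hk, h⟩)
    · exact keep h
    by_cases hki : k = i
    · exact keep (hki ▸ h)
    have hek : τ ∈ ε.exch k i := (hτe i k).2 ((Sym2.mem_and_mem_iff hki).1 ⟨hk, hi⟩)
    -- If the partner is `j`, what is received is its value at `τ`, which is recent enough because
    -- `t' ≤ a < τ`.
    rcases h with rfl | ⟨τ₀, h1, h⟩
    · exact Or.inr ⟨τ, ht'.trans_lt haτ, .direct k i τ hek⟩
    · exact Or.inr ⟨τ₀, h1, .receive k i a τ _ hek h haτ (hr k)⟩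

end Deterministic

/-! ### Chains driven by independent counts -/

section Chain

variable {Ω : Type*} [mΩ : MeasurableSpace Ω] {μ : Measure Ω} {ι D : Type*} [Fintype ι]
  [DecidableEq ι]

/-- If exactly one of the counts is `1` and the others vanish, apply the corresponding update;
otherwise do nothing. -/
noncomputable def singleUpdate (upd : ι → D → D) (V : ι → ℕ) (B : D) : D :=
  open Classical in if h : ∃ c, V = Pi.single c 1 then upd h.choose B else B

lemma singleUpdate_single (upd : ι → D → D) (c : ι) (B : D) :
    singleUpdate upd (Pi.single c 1) B = upd c B := by
  have h : ∃ c', (Pi.single c 1 : ι → ℕ) = Pi.single c' 1 := ⟨c, rfl⟩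
  rw [singleUpdate, dif_pos h]
  have := h.choose_spec
  by_contra hne
  have hc : h.choose ≠ c := fun h' => hne (by rw [h'])
  have := congrFun this c
  simp [hc.symm] at this

lemma singleUpdate_of_not (upd : ι → D → D) {V : ι → ℕ} (h : ¬ ∃ c, V = Pi.single c 1) (B : D) :
    singleUpdate upd V B = B := by
  rw [singleUpdate, dif_neg h]

lemma singleUpdate_zero (upd : ι → D → D) (B : D) : singleUpdate upd 0 B = B := by
  refine singleUpdate_of_not upd ?_ B
  rintro ⟨c, hc⟩
  simpa using congrFun hc c

/-- The indicator function of the event that only the `c`-th count is non-zero, and is `1`. -/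
noncomputable def singleTick (c : ι) : (ι → ℕ) → ℝ :=
  Set.indicator {Pi.single c 1} fun _ => 1

/-- At most one indicator is non-zero, so the update becomes linear in the indicators and
expectations split over the clocks. -/
lemma comp_singleUpdate (upd : ι → D → D) (V : ι → ℕ) (B : D) (g : D → ℝ) :
    g (singleUpdate upd V B) =
      g B + ∑ c, singleTick c V * (g (upd c B) - g B) := by
  by_cases h : ∃ c, V = Pi.single c 1
  · obtain ⟨c, rfl⟩ := h
    rw [singleUpdate_single, Finset.sum_eq_single c]
    · simp [singleTick]
    · intro c' _ hc'
      rw [singleTick, Set.indicator_of_notMem, zero_mul]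
      intro h
      have := congrFun (Set.mem_singleton_iff.1 h) c
      simp [hc'.symm] at this
    · simp
  · rw [singleUpdate_of_not upd h, Finset.sum_eq_zero, add_zero]
    intro c _
    rw [singleTick, Set.indicator_of_notMem, zero_mul]
    exact fun h' => h ⟨c, h'⟩

/-- The chain whose `q`-th step is driven by the counts `T · q`. -/
noncomputable def countChain (upd : ι → D → D) (T : ι → ℕ → Ω → ℕ) (x₀ : D) : ℕ → Ω → D
  | 0, _ => x₀
  | q + 1, ω => singleUpdate upd (fun c => T c q ω) (countChain upd T x₀ q ω)

/-- The generator associated to updates occurring at rates `r`. -/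
def updateGenerator (upd : ι → D → D) (r : ι → ℝ) (g : D → ℝ) (B : D) : ℝ :=
  ∑ c, r c * (g (upd c B) - g B)

/-- The σ-algebra generated by the counts of the first `q` steps. -/
@[reducible] def countPast (T : ι → ℕ → Ω → ℕ) (q : ℕ) : MeasurableSpace Ω :=
  ⨆ p ∈ {p : ι × ℕ | p.2 < q}, MeasurableSpace.comap (T p.1 p.2) inferInstance

/-- `T c q` are independent Poisson counts with parameters `r c * h q`, as far as the values
`0` and `1` are concerned. -/
structure PoissonCounts (μ : Measure Ω) (T : ι → ℕ → Ω → ℕ) (r : ι → ℝ) (h : ℕ → ℝ) : Prop where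
  measurable : ∀ c q, Measurable (T c q)
  rate_nonneg : ∀ c, 0 ≤ r c
  step_nonneg : ∀ q, 0 ≤ h q
  indep : iIndepFun (fun (p : ι × ℕ) ω => T p.1 p.2 ω) μ
  prob_zero : ∀ c q, μ.real (T c q ⁻¹' {0}) = Real.exp (-(r c * h q))
  prob_one : ∀ c q, μ.real (T c q ⁻¹' {1}) = r c * h q * Real.exp (-(r c * h q))

variable {T : ι → ℕ → Ω → ℕ} {r : ι → ℝ} {h : ℕ → ℝ}

omit mΩ [Fintype ι] [DecidableEq ι] in
lemma countPast_mono {q q' : ℕ} (hq : q ≤ q') : countPast T q ≤ countPast T q' :=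
  biSup_mono fun _ hp => lt_of_lt_of_le hp hq

omit [Fintype ι] [DecidableEq ι] in
lemma PoissonCounts.countPast_le (hT : PoissonCounts μ T r h) (q : ℕ) : countPast T q ≤ mΩ :=
  iSup₂_le fun p _ => (hT.measurable p.1 p.2).comap_le

omit mΩ [Fintype ι] [DecidableEq ι] in
lemma measurable_countPast (c : ι) {q q' : ℕ} (hq : q < q') :
    Measurable[countPast T q'] (T c q) := by
  have : MeasurableSpace.comap (T c q) inferInstance ≤ countPast T q' :=
    le_iSup₂_of_le (f := fun (p : ι × ℕ) (_ : p ∈ {p : ι × ℕ | p.2 < q'}) =>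
      MeasurableSpace.comap (T p.1 p.2) inferInstance) (c, q) hq le_rfl
  exact Measurable.of_comap_le this

variable [MeasurableSpace D] [DiscreteMeasurableSpace D] [Finite D]

-- Adaptedness to the counts of the first `q` steps is what makes the chain independent of the
-- counts of step `q`.
omit mΩ in
lemma measurable_countChain (upd : ι → D → D) (x₀ : D) (q : ℕ) :
    Measurable[countPast T q] (countChain upd T x₀ q) := by
  induction q with
  | zero => exact measurable_const
  | succ q ih =>
    have h1 : Measurable[countPast T (q + 1)] fun ω c => T c q ω :=
      @measurable_pi_lambda _ _ _ (countPast T (q + 1)) _ _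
        fun c => measurable_countPast c (Nat.lt_succ_self q)
    have h2 : Measurable[countPast T (q + 1)] (countChain upd T x₀ q) :=
      ih.mono (countPast_mono (Nat.le_succ q)) le_rfl
    have h3 : Measurable fun x : (ι → ℕ) × D => singleUpdate upd x.1 x.2 := Measurable.of_discrete
    have h4 : Measurable[countPast T (q + 1)]
        fun ω => ((fun c => T c q ω, countChain upd T x₀ q ω) : (ι → ℕ) × D) := h1.prodMk h2
    exact h3.comp h4

lemma PoissonCounts.real_single [IsProbabilityMeasure μ] (hT : PoissonCounts μ T r h)
    (c : ι) (q : ℕ) :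
    μ.real ((fun ω c => T c q ω) ⁻¹' {Pi.single c 1}) =
      r c * (h q * Real.exp (-((∑ c, r c) * h q))) := by
  have hi : iIndepFun (fun c => T c q) μ :=
    hT.indep.precomp (g := fun c => (c, q)) fun a b hab => (Prod.ext_iff.1 hab).1
  have hset : (fun ω c => T c q ω) ⁻¹' {Pi.single c 1} =
      ⋂ c' ∈ (Finset.univ : Finset ι), T c' q ⁻¹' {(Pi.single c 1 : ι → ℕ) c'} := by
    ext ω
    simp [funext_iff]
  rw [hset, measureReal_def, hi.measure_inter_preimage_eq_mul _ fun _ _ => .of_discrete,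
    ENNReal.toReal_prod]
  simp only [← measureReal_def]
  have hp : ∀ c', μ.real (T c' q ⁻¹' {(Pi.single c 1 : ι → ℕ) c'}) =
      (if c' = c then r c * h q else 1) * Real.exp (-(r c' * h q)) := by
    intro c'
    by_cases hc : c' = c
    · subst hc
      simp [hT.prob_one]
    · simp [hc, hT.prob_zero]
  simp only [hp, Finset.prod_mul_distrib, Finset.prod_ite_eq', Finset.mem_univ, if_true,
    ← Real.exp_sum, Finset.sum_neg_distrib, ← Finset.sum_mul]
  ring

omit [DecidableEq ι] in
lemma PoissonCounts.real_zero [IsProbabilityMeasure μ] (hT : PoissonCounts μ T r h) (q : ℕ) :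
    μ.real ((fun ω c => T c q ω) ⁻¹' {0}) = Real.exp (-((∑ c, r c) * h q)) := by
  have hi : iIndepFun (fun c => T c q) μ :=
    hT.indep.precomp (g := fun c => (c, q)) fun a b hab => (Prod.ext_iff.1 hab).1
  have hset : (fun ω c => T c q ω) ⁻¹' {0} =
      ⋂ c' ∈ (Finset.univ : Finset ι), T c' q ⁻¹' {0} := by
    ext ω
    simp [funext_iff]
  rw [hset, measureReal_def, hi.measure_inter_preimage_eq_mul _ fun _ _ => .of_discrete,
    ENNReal.toReal_prod]
  simp only [← measureReal_def, hT.prob_zero, ← Real.exp_sum, Finset.sum_neg_distrib,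
    ← Finset.sum_mul]

/-- The event that step `q` has at least two ticks. -/
def multipleTicks (T : ι → ℕ → Ω → ℕ) (q : ℕ) : Set Ω :=
  {ω | ¬ ((fun c => T c q ω) = 0 ∨ ∃ c, (fun c => T c q ω) = Pi.single c 1)}

lemma PoissonCounts.real_multipleTicks_le [IsProbabilityMeasure μ] (hT : PoissonCounts μ T r h)
    (q : ℕ) : μ.real (multipleTicks T q) ≤ ((∑ c, r c) * h q) ^ 2 := by
  have hV : Measurable fun ω c => T c q ω := measurable_pi_lambda _ fun c => hT.measurable c q
  have hset : multipleTicks T q = ((fun ω c => T c q ω) ⁻¹' ({0} ∪ ⋃ c, {Pi.single c 1}))ᶜ := by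
    ext ω
    simp only [multipleTicks, Set.mem_ofPred_eq, Set.mem_compl_iff, Set.mem_preimage,
      Set.mem_union, Set.mem_singleton_iff, Set.mem_iUnion]
  have hdisj : Disjoint ({0} : Set (ι → ℕ)) (⋃ c, {Pi.single c 1}) := by
    rw [Set.disjoint_left]
    rintro V rfl hV'
    obtain ⟨c, hc⟩ := Set.mem_iUnion.1 hV'
    simpa using congrFun (Set.mem_singleton_iff.1 hc) c
  have hpair : Pairwise (Function.onFun Disjoint
      fun c => (fun ω c => T c q ω) ⁻¹' {(Pi.single c 1 : ι → ℕ)}) := by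
    intro c c' hcc
    refine Disjoint.preimage _ (Set.disjoint_singleton.2 fun h' => ?_)
    have := congrFun h' c
    simp [hcc] at this
  have hsum : μ.real ((fun ω c => T c q ω) ⁻¹' ({0} ∪ ⋃ c, {Pi.single c 1})) =
      Real.exp (-((∑ c, r c) * h q)) * (1 + (∑ c, r c) * h q) := by
    rw [Set.preimage_union, measureReal_union (hdisj.preimage _) (hV .of_discrete), hT.real_zero,
      Set.preimage_iUnion, measureReal_iUnion_fintype hpair fun c => hV .of_discrete]
    simp only [hT.real_single, ← Finset.sum_mul]
    ring
  rw [hset, measureReal_compl (hV .of_discrete), hsum, probReal_univ]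
  have hX : 0 ≤ (∑ c, r c) * h q :=
    mul_nonneg (Finset.sum_nonneg fun c _ => hT.rate_nonneg c) (hT.step_nonneg q)
  -- With `X` the total rate times the step, `e^{-X} ≥ 1 - X` gives `1 - (1 + X) e^{-X} ≤ 1 - (1 +
  -- X)(1 - X) = X²`.
  nlinarith [Real.add_one_le_exp (-((∑ c, r c) * h q))]

/-- One step of the chain, tested against a function `Y` of the past. -/
lemma PoissonCounts.integral_countChain_succ [IsProbabilityMeasure μ] (hT : PoissonCounts μ T r h)
    (upd : ι → D → D) (x₀ : D) (q : ℕ) {Y : Ω → ℝ} (hY : Measurable[countPast T q] Y)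
    (hb : ∀ ω, |Y ω| ≤ 1) (g : D → ℝ) :
    ∫ ω, Y ω * g (countChain upd T x₀ (q + 1) ω) ∂μ =
      ∫ ω, Y ω * g (countChain upd T x₀ q ω) ∂μ +
        h q * Real.exp (-((∑ c, r c) * h q)) *
          ∫ ω, Y ω * updateGenerator upd r g (countChain upd T x₀ q ω) ∂μ := by
  have hV : Measurable fun ω c => T c q ω := measurable_pi_lambda _ fun c => hT.measurable c q
  have hX := measurable_countChain (T := T) upd x₀ q
  have hYg : ∀ f : D → ℝ, Measurable[countPast T q] fun ω => Y ω * f (countChain upd T x₀ q ω) :=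
    fun f => hY.mul ((Measurable.of_discrete (f := f)).comp hX)
  have hint : ∀ f : D → ℝ, Integrable (fun ω => Y ω * f (countChain upd T x₀ q ω)) μ := by
    intro f
    obtain ⟨C, hC⟩ := (Set.finite_range fun B => |f B|).bddAbove
    refine Integrable.of_bound ((hYg f).mono (hT.countPast_le q) le_rfl).aestronglyMeasurable
      (1 * C) (ae_of_all _ fun ω => ?_)
    rw [Real.norm_eq_abs, abs_mul]
    exact mul_le_mul (hb ω) (hC ⟨_, rfl⟩) (abs_nonneg _) zero_le_one
  -- The counts of step `q` and those of the earlier steps generate independent σ-algebras, being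
  -- indexed by disjoint sets of pairs.
  have hindep : ∀ (c : ι) (f : D → ℝ),
      IndepFun (fun ω => singleTick c
        (fun c => T c q ω)) (fun ω => Y ω * f (countChain upd T x₀ q ω)) μ := by
    intro c f
    have hI := indep_iSup_of_disjoint (m := fun p : ι × ℕ =>
      MeasurableSpace.comap (T p.1 p.2) inferInstance)
      (fun p => (hT.measurable p.1 p.2).comap_le) hT.indep
      (S := {p | p.2 = q}) (T := {p | p.2 < q})
      (Set.disjoint_left.2 fun p hp hp' => by
        simp only [Set.mem_ofPred_eq] at hp hp'; omega)
    refine indep_of_indep_of_le hI (Measurable.comap_le ?_) (hYg f).comap_le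
    refine Measurable.comp (Measurable.of_discrete (f := singleTick c)) ?_
    refine @measurable_pi_lambda _ _ _ (_) _ _ fun c => Measurable.of_comap_le ?_
    exact le_iSup₂_of_le (f := fun (p : ι × ℕ) (_ : p ∈ {p : ι × ℕ | p.2 = q}) =>
      MeasurableSpace.comap (T p.1 p.2) inferInstance) (c, q) rfl le_rfl
  have hprod : ∀ (c : ι) (f : D → ℝ),
      Integrable (fun ω => singleTick c
        (fun c => T c q ω) * (Y ω * f (countChain upd T x₀ q ω))) μ ∧
      ∫ ω, singleTick c
        (fun c => T c q ω) * (Y ω * f (countChain upd T x₀ q ω)) ∂μ =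
      r c * (h q * Real.exp (-((∑ c, r c) * h q))) *
        ∫ ω, Y ω * f (countChain upd T x₀ q ω) ∂μ := by
    intro c f
    have hm : Measurable fun ω => singleTick c
        (fun c => T c q ω) := (Measurable.of_discrete (f := singleTick c)).comp hV
    have hi1 : Integrable (fun ω => singleTick c
        (fun c => T c q ω)) μ := by
      refine Integrable.of_bound hm.aestronglyMeasurable 1 (ae_of_all _ fun ω => ?_)
      by_cases h' : (fun c => T c q ω) ∈ ({(Pi.single c 1 : ι → ℕ)} : Set (ι → ℕ)) <;>
        simp [singleTick, h']
    refine ⟨(hindep c f).integrable_mul hi1 (hint f), ?_⟩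
    rw [(hindep c f).integral_fun_mul_eq_mul_integral hm.aestronglyMeasurable
      (hint f).aestronglyMeasurable, ← hT.real_single c q]
    congr 1
    rw [← integral_indicator_one (hV .of_discrete)]
    rfl
  have hexp : ∀ ω, Y ω * g (countChain upd T x₀ (q + 1) ω) =
      Y ω * g (countChain upd T x₀ q ω) +
        ∑ c, singleTick c (fun c => T c q ω) *
          (Y ω * (fun B => g (upd c B) - g B) (countChain upd T x₀ q ω)) := by
    intro ω
    rw [countChain, comp_singleUpdate _ _ _ g, mul_add, Finset.mul_sum]
    congr 1
    refine Finset.sum_congr rfl fun c _ => by ring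
  rw [integral_congr_ae (ae_of_all _ hexp),
    integral_add (hint g) (integrable_finsetSum _ fun c _ =>
      (hprod c fun B => g (upd c B) - g B).1),
    integral_finsetSum _ fun c _ => (hprod c fun B => g (upd c B) - g B).1]
  congr 1
  simp_rw [fun c => (hprod c (fun B => g (upd c B) - g B)).2, updateGenerator, Finset.mul_sum]
  rw [integral_finsetSum, Finset.mul_sum]
  · refine Finset.sum_congr rfl fun c _ => ?_
    have : ∀ ω, Y ω * (r c * (g (upd c (countChain upd T x₀ q ω)) - g (countChain upd T x₀ q ω)))
        = r c * (Y ω * (g (upd c (countChain upd T x₀ q ω)) - g (countChain upd T x₀ q ω))) :=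
      fun ω => by ring
    simp_rw [this, integral_const_mul]
    ring
  · exact fun c _ => hint fun B => r c * (g (upd c B) - g B)

end Chain

/-! ### The update of the set of informed agents -/

section Update

variable {N : ℕ}

/-- The clocks are those of the agents and those of the pairs of agents. -/
def gossipClockEquiv (N : ℕ) :
    Fin N ⊕ {e : Sym2 (Fin N) // ¬ e.IsDiag} ≃ GossipClock N where
  toFun := Sum.elim .repl .pair
  invFun c := match c with
    | .repl i => Sum.inl i
    | .pair e => Sum.inr e
  left_inv := by rintro (i | e) <;> rfl
  right_inv := by rintro (i | e) <;> rfl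

noncomputable instance : Fintype (GossipClock N) := Fintype.ofEquiv _ (gossipClockEquiv N)

noncomputable instance : DecidableEq (GossipClock N) := Classical.decEq _

instance : MeasurableSpace (Finset (Fin N)) := ⊤

instance : DiscreteMeasurableSpace (Finset (Fin N)) := ⟨fun _ => trivial⟩

lemma sum_gossipClock (F : GossipClock N → ℝ) :
    ∑ c, F c = ∑ i, F (.repl i) + ∑ e, F (.pair e) := by
  rw [← (gossipClockEquiv N).sum_comp, Fintype.sum_sum_type]
  rfl

open Classical in
/-- The effect of a tick of the clock `c` on the set `B` of agents informed about `j`. -/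
noncomputable def gossipUpdate (j : Fin N) : GossipClock N → Finset (Fin N) → Finset (Fin N)
  | .repl i, B => insert j ((insert j B).erase i)
  | .pair e, B => Finset.univ.filter fun i =>
      i ∈ insert j B ∨ (i ∈ e.1 ∧ ∃ k ∈ e.1, k ∈ insert j B)

lemma mem_gossipUpdate (j : Fin N) (c : GossipClock N) (B : Finset (Fin N)) :
    j ∈ gossipUpdate j c B := by
  cases c <;> simp [gossipUpdate]

/-- Since only `insert j B` matters, the identities for the generator hold for every `B`, and the
invariant `j ∈ B` need not be carried along the chain. -/
lemma gossipUpdate_insert (j : Fin N) (c : GossipClock N) (B : Finset (Fin N)) :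
    gossipUpdate j c (insert j B) = gossipUpdate j c B := by
  cases c <;> simp [gossipUpdate]

open Classical in
/-- The number of pairs with exactly one member in `B`. -/
lemma card_crossing_pairs (B : Finset (Fin N)) :
    (Finset.univ.filter fun e : {e : Sym2 (Fin N) // ¬ e.IsDiag} =>
      (∃ a ∈ e.1, a ∈ B) ∧ ∃ b ∈ e.1, b ∉ B).card = B.card * (N - B.card) := by
  have h : (B ×ˢ Bᶜ).card = B.card * (N - B.card) := by
    rw [Finset.card_product, Finset.card_compl, Fintype.card_fin]
  rw [← h]
  symm
  refine Finset.card_bij (fun p hp => ⟨s(p.1, p.2), ?_⟩) ?_ ?_ ?_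
  · simp only [Finset.mem_product, Finset.mem_compl] at hp
    rw [Sym2.mk_isDiag_iff]
    exact fun h' => hp.2 (h' ▸ hp.1)
  · intro p hp
    simp only [Finset.mem_product, Finset.mem_compl] at hp
    simp only [Finset.mem_filter, Finset.mem_univ, true_and]
    exact ⟨⟨p.1, Sym2.mem_mk_left _ _, hp.1⟩, ⟨p.2, Sym2.mem_mk_right _ _, hp.2⟩⟩
  · rintro ⟨a, b⟩ hp ⟨a', b'⟩ hp' h'
    simp only [Finset.mem_product, Finset.mem_compl] at hp hp'
    rw [Subtype.mk.injEq, Sym2.eq_iff] at h'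
    rcases h' with ⟨rfl, rfl⟩ | ⟨rfl, rfl⟩
    · rfl
    · exact absurd hp.1 hp'.2
  · rintro ⟨e, he⟩ h'
    simp only [Finset.mem_filter, Finset.mem_univ, true_and] at h'
    obtain ⟨⟨a, hae, ha⟩, b, hbe, hb⟩ := h'
    have hab : a ≠ b := fun h' => hb (h' ▸ ha)
    refine ⟨(a, b), by simp [ha, hb], ?_⟩
    rw [Subtype.mk.injEq]
    exact ((Sym2.mem_and_mem_iff hab).1 ⟨hae, hbe⟩).symm

lemma card_gossipUpdate_repl {j : Fin N} {B : Finset (Fin N)} (hj : j ∈ B) (i : Fin N) :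
    (gossipUpdate j (.repl i) B).card = if i ∈ B.erase j then B.card - 1 else B.card := by
  rw [gossipUpdate, Finset.insert_eq_of_mem hj]
  by_cases hij : i = j
  · subst hij
    simp [Finset.insert_erase hj]
  · rw [Finset.insert_eq_of_mem (Finset.mem_erase.2 ⟨Ne.symm hij, hj⟩)]
    by_cases hi : i ∈ B
    · simp [hij, hi, Finset.card_erase_of_mem]
    · simp [hi, Finset.erase_eq_of_notMem]

open Classical in
lemma card_gossipUpdate_pair {j : Fin N} {B : Finset (Fin N)} (hj : j ∈ B)
    (e : {e : Sym2 (Fin N) // ¬ e.IsDiag}) :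
    (gossipUpdate j (.pair e) B).card =
      if (∃ a ∈ e.1, a ∈ B) ∧ ∃ b ∈ e.1, b ∉ B then B.card + 1 else B.card := by
  rw [gossipUpdate, Finset.insert_eq_of_mem hj]
  split_ifs with h
  · obtain ⟨⟨a, hae, ha⟩, b, hbe, hb⟩ := h
    have hab : a ≠ b := fun h' => hb (h' ▸ ha)
    have he := (Sym2.mem_and_mem_iff hab).1 ⟨hae, hbe⟩
    rw [← Finset.card_insert_of_notMem hb]
    congr 1
    ext i
    simp only [Finset.mem_filter, Finset.mem_univ, true_and, Finset.mem_insert]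
    constructor
    · rintro (h | ⟨h, -⟩)
      · exact Or.inr h
      · rw [he, Sym2.mem_iff] at h
        rcases h with rfl | rfl
        · exact Or.inr ha
        · exact Or.inl rfl
    · rintro (rfl | h)
      · exact Or.inr ⟨hbe, a, hae, ha⟩
      · exact Or.inl h
  · congr 1
    ext i
    simp only [Finset.mem_filter, Finset.mem_univ, true_and]
    refine ⟨?_, Or.inl⟩
    rintro (h' | ⟨h1, h2⟩)
    · exact h'
    · by_contra hi
      exact h ⟨h2, i, h1, hi⟩

/-- The rates of the clocks as real numbers. -/
noncomputable def clockRate (N : ℕ) (lamC lamR : ℝ≥0) (c : GossipClock N) : ℝ :=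
  (c.rate lamC lamR : ℝ≥0)

/-- The number of informed agents changes like the birth–death chain. -/
lemma updateGenerator_card (lamC lamR : ℝ≥0) (j : Fin N) (f : ℕ → ℝ) (B : Finset (Fin N)) :
    updateGenerator (gossipUpdate j) (clockRate N lamC lamR) (fun B => f (insert j B).card) B =
      gossipBirth N lamC (insert j B).card *
          (f ((insert j B).card + 1) - f (insert j B).card) +
        gossipDeath lamR (insert j B).card *
          (f ((insert j B).card - 1) - f (insert j B).card) := by
  classical
  have hins : ∀ c, insert j (gossipUpdate j c B) = gossipUpdate j c (insert j B) := fun c => by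
    rw [Finset.insert_eq_of_mem (mem_gossipUpdate j c B), gossipUpdate_insert]
  simp only [updateGenerator, hins]
  have hjB : j ∈ insert j B := Finset.mem_insert_self j B
  generalize insert j B = B' at *
  have hN : 1 ≤ N := j.pos
  have hB : B'.card ≤ N := by simpa using Finset.card_le_univ B'
  have hB1 : 1 ≤ B'.card := Finset.card_pos.2 ⟨j, hjB⟩
  have h1 : ∀ i, clockRate N lamC lamR (.repl i) *
      (f (gossipUpdate j (.repl i) B').card - f B'.card) =
      if i ∈ B'.erase j then lamR * (f (B'.card - 1) - f B'.card) else 0 := by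
    intro i
    rw [card_gossipUpdate_repl hjB]
    split_ifs <;> simp [clockRate, GossipClock.rate]
  have h2 : ∀ e, clockRate N lamC lamR (.pair e) *
      (f (gossipUpdate j (.pair e) B').card - f B'.card) =
      if (∃ a ∈ e.1, a ∈ B') ∧ ∃ b ∈ e.1, b ∉ B' then
        lamC / ((N : ℝ) - 1) * (f (B'.card + 1) - f B'.card) else 0 := by
    intro e
    rw [card_gossipUpdate_pair hjB]
    have hc : ((N - 1 : ℕ) : ℝ) = (N : ℝ) - 1 := by push_cast [Nat.cast_sub hN]; rfl
    split_ifs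
    · rw [← hc]
      rfl
    · rw [sub_self, mul_zero]
  rw [sum_gossipClock]
  simp only [h1, h2]
  -- The contributing clocks are the replacements of informed agents other than `j` and the pairs
  -- with exactly one informed member; it remains to count them.
  rw [← Finset.sum_filter, ← Finset.sum_filter, Finset.sum_const, Finset.sum_const,
    card_crossing_pairs, Finset.filter_mem_eq_inter, Finset.univ_inter,
    Finset.card_erase_of_mem hjB]
  simp only [nsmul_eq_mul, gossipBirth, gossipDeath, Nat.cast_mul, Nat.cast_sub hB,
    Nat.cast_sub hB1, Nat.cast_one]
  ring

/-- The indicator function of the sets of informed agents with `k + 1` elements. -/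
noncomputable def cardIndicator (j : Fin N) (k : Fin N) (B : Finset (Fin N)) : ℝ :=
  if (insert j B).card = k + 1 then 1 else 0

/-- This is the lumping property: the indicators of the values of the count span a space stable
under the generator, which acts there by the birth–death matrix. Only the column of the current
state contributes. -/
lemma updateGenerator_cardIndicator (lamC lamR : ℝ≥0) (j k : Fin N) (B : Finset (Fin N)) :
    updateGenerator (gossipUpdate j) (clockRate N lamC lamR) (cardIndicator j k) B =
      ∑ c, birthDeathGenerator N (gossipBirth N lamC) (gossipDeath lamR) k c *
        cardIndicator j c B := by
  have h := updateGenerator_card lamC lamR j (fun n => if n = (k : ℕ) + 1 then 1 else 0) B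
  have hB : (insert j B).card ≤ N := by simpa using Finset.card_le_univ (insert j B)
  have hB1 : 1 ≤ (insert j B).card := Finset.card_pos.2 ⟨j, Finset.mem_insert_self j B⟩
  obtain ⟨l, hl⟩ : ∃ l : Fin N, (insert j B).card = l + 1 :=
    ⟨⟨(insert j B).card - 1, by omega⟩, (Nat.sub_add_cancel hB1).symm⟩
  refine h.trans ?_
  rw [Finset.sum_eq_single l]
  · simp only [cardIndicator, hl, birthDeathGenerator, Matrix.of_apply, if_true, mul_one,
      Nat.add_sub_cancel, Fin.ext_iff]
    by_cases h1 : (k : ℕ) = l + 1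
    · have h2 : ¬ ((l : ℕ) = k + 1) := by omega
      have h3 : ¬ ((l : ℕ) + 1 = k + 1) := by omega
      have h4 : ¬ ((l : ℕ) = l + 1 + 1) := by omega
      simp [h1, h4]
    · by_cases h2 : (l : ℕ) = k + 1
      · have h4 : ¬ ((k : ℕ) = k + 1 + 1) := by omega
        have h5 : ¬ ((k : ℕ) + 1 + 1 = k) := by omega
        simp [h2, h4, h5]
      · by_cases h3 : (k : ℕ) = l
        · simp [h3]; ring
        · have h4 : ¬ ((l : ℕ) = k) := fun h => h3 h.symm
          have h5 : ¬ ((l : ℕ) + 1 = k) := fun h => h1 h.symm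
          simp [h1, h2, h3, h4, h5]
  · intro c _ hc
    rw [cardIndicator, hl, if_neg, mul_zero]
    exact fun h => hc (Fin.ext (by omega))
  · simp

/-- Relabelling the agents other than `j` preserves the dynamics. -/
lemma updateGenerator_map (lamC lamR : ℝ≥0) (j : Fin N) (σ : Equiv.Perm (Fin N)) (hσ : σ j = j)
    (g : Finset (Fin N) → ℝ) (B : Finset (Fin N)) :
    updateGenerator (gossipUpdate j) (clockRate N lamC lamR)
        (fun B => g (B.map σ.toEmbedding)) B =
      updateGenerator (gossipUpdate j) (clockRate N lamC lamR) g (B.map σ.toEmbedding) := by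
  classical
  have hrepl : ∀ i, (gossipUpdate j (.repl i) B).map σ.toEmbedding =
      gossipUpdate j (.repl (σ i)) (B.map σ.toEmbedding) := by
    intro i
    ext a
    simp only [gossipUpdate, Finset.mem_map_equiv, Finset.mem_insert, Finset.mem_erase,
      Equiv.symm_apply_eq, hσ, ne_eq]
  let τ : {e : Sym2 (Fin N) // ¬ e.IsDiag} ≃ {e : Sym2 (Fin N) // ¬ e.IsDiag} :=
    { toFun := fun e => ⟨e.1.map σ, fun h => e.2 ((Sym2.isDiag_map σ.injective).1 h)⟩
      invFun := fun e => ⟨e.1.map σ.symm, fun h => e.2 ((Sym2.isDiag_map σ.symm.injective).1 h)⟩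
      left_inv := fun e => Subtype.ext (by simp [Sym2.map_map])
      right_inv := fun e => Subtype.ext (by simp [Sym2.map_map]) }
  have hpair : ∀ e, (gossipUpdate j (.pair e) B).map σ.toEmbedding =
      gossipUpdate j (.pair (τ e)) (B.map σ.toEmbedding) := by
    rintro ⟨e, he⟩
    induction e with
    | _ a b =>
      ext i
      have : τ ⟨s(a, b), he⟩ = ⟨s(σ a, σ b), by simpa using he⟩ := rfl
      rw [this]
      simp only [gossipUpdate, Finset.mem_map_equiv, Finset.mem_insert, Finset.mem_filter,
        Finset.mem_univ, true_and, Sym2.mem_iff, exists_eq_or_imp, exists_eq_left,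
        Equiv.symm_apply_eq, hσ, Equiv.symm_apply_apply]
      simp only [σ.injective.eq_iff' hσ]
  simp only [updateGenerator]
  rw [sum_gossipClock, sum_gossipClock]
  -- All replacement clocks have the same rate, and so do all pair clocks, so reindexing the two
  -- sums leaves the coefficients unchanged.
  conv_rhs => rw [← Equiv.sum_comp σ, ← Equiv.sum_comp τ]
  simp only [hrepl, hpair]
  rfl

end Update

/-! ### The Gossip model observed on a mesh -/

section Mesh

variable {Ω : Type*} [mΩ : MeasurableSpace Ω] {μ : Measure Ω} {N : ℕ} {lamC lamR : ℝ≥0}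
  {sigma : ℝ}

namespace GossipModel

/-- The number of ticks of the clock `c` in the `q`-th interval of a mesh. -/
noncomputable def meshCount (G : GossipModel μ N lamC lamR sigma) (v : ℕ → ℝ)
    (c : GossipClock N) (q : ℕ) : Ω → ℕ :=
  tickCount (G.ticks c) (v q) (v (q + 1))

lemma poissonCounts (G : GossipModel μ N lamC lamR sigma) {v : ℕ → ℝ} (hv : Monotone v)
    (h0 : 0 ≤ v 0) :
    PoissonCounts μ (G.meshCount v) (clockRate N lamC lamR) (fun q => v (q + 1) - v q) := by
  have hm : ∀ c q, Measurable (G.meshCount v c q) := fun c q =>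
    (G.poisson c).measurable_count _ _
  have hle : ∀ q, v q ≤ v (q + 1) := fun q => hv (Nat.le_succ q)
  have hlaw : ∀ c q n, μ.real (G.meshCount v c q ⁻¹' {n}) =
      Real.exp (-(clockRate N lamC lamR c * (v (q + 1) - v q))) *
        (clockRate N lamC lamR c * (v (q + 1) - v q)) ^ n / n.factorial := by
    intro c q n
    have h := (G.poisson c).law (v q) (v (q + 1)) (h0.trans (hv (Nat.zero_le q))) (hle q)
    rw [← map_measureReal_apply (hm c q) (.of_discrete)]
    unfold meshCount
    rw [h, poissonMeasure_real_singleton]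
    simp only [NNReal.coe_mul, Real.coe_toNNReal _ (sub_nonneg.2 (hle q)), clockRate]
  refine ⟨hm, fun c => NNReal.coe_nonneg _, fun q => sub_nonneg.2 (hle q), ?_, ?_, ?_⟩
  -- Independence over all pairs (clock, step) combines the independence of the clocks with that of
  -- the successive counts of each single clock.
  · refine iIndepFun_uncurry' (X := G.meshCount v) hm ?_ fun c => (G.poisson c).indep v h0 hv
    have h1 := G.indep.precomp (Option.some_injective (GossipClock N))
    refine iIndep_of_iIndep_of_le h1 fun c => Measurable.comap_le ?_
    refine @measurable_pi_lambda _ _ _ (_) _ _ fun q => Measurable.of_comap_le ?_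
    exact le_iSup₂_of_le (f := fun a b : ℝ =>
      MeasurableSpace.comap (tickCount (G.ticks c) a b) inferInstance) (v q) (v (q + 1)) le_rfl
  · intro c q
    simpa using hlaw c q 0
  · intro c q
    rw [hlaw c q 1]
    simp [mul_comm]

lemma events_exch_pos (G : GossipModel μ N lamC lamR sigma) (ω : Ω) (i k : Fin N) :
    (G.events ω).exch i k ⊆ Ioi 0 := by
  rintro τ ⟨e, -, he⟩
  exact (G.poisson _).pos ω he

open Classical in
/-- The set of agents that are informed about `j` with an information more recent than `t'`. -/
noncomputable def informedSet (G : GossipModel μ N lamC lamR sigma) (j : Fin N) (t' t : ℝ)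
    (ω : Ω) : Finset (Fin N) :=
  Finset.univ.filter (Informed (G.events ω) j t' t)

lemma mem_informedSet {G : GossipModel μ N lamC lamR sigma} {j i : Fin N} {t' t : ℝ} {ω : Ω} :
    i ∈ G.informedSet j t' t ω ↔ Informed (G.events ω) j t' t i := by
  simp [informedSet]

lemma self_mem_informedSet (G : GossipModel μ N lamC lamR sigma) (j : Fin N) (t' t : ℝ) (ω : Ω) :
    j ∈ G.informedSet j t' t ω := mem_informedSet.2 (Or.inl rfl)

lemma informedSet_self (G : GossipModel μ N lamC lamR sigma) (j : Fin N) (t : ℝ) (ω : Ω) :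
    G.informedSet j t t ω = {j} := by
  ext i
  rw [mem_informedSet, informed_self_iff, Finset.mem_singleton]

lemma numInformed_eq (G : GossipModel μ N lamC lamR sigma) (j : Fin N) (t' t : ℝ) (ω : Ω) :
    numInformed (G.events ω) j t t' = (G.informedSet j t' t ω).card := by
  classical
  rw [numInformed, informedSet, ← Set.ncard_coe_finset]
  congr 1
  ext i
  simp [Informed, knowledgeSet]

lemma ticks_inter_finite (G : GossipModel μ N lamC lamR sigma) (c : GossipClock N) (a b : ℝ)
    (ω : Ω) : (G.ticks c ω ∩ Ioc a b).Finite :=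
  ((G.poisson c).locallyFinite ω b).subset (Set.inter_subset_inter_right _ Ioc_subset_Iic_self)

lemma informedSet_eq_of_no_tick (G : GossipModel μ N lamC lamR sigma) (j : Fin N) {t' a b : ℝ}
    (h0 : 0 ≤ a) (hab : a ≤ b) {ω : Ω} (h : ∀ c, ∀ r ∈ Ioc a b, r ∉ G.ticks c ω) :
    G.informedSet j t' b ω = G.informedSet j t' a ω := by
  ext i
  rw [mem_informedSet, mem_informedSet]
  refine informed_iff_of_no_event h0 hab (fun i r hr => h _ r hr) ?_
  rintro i k r hr ⟨e, -, he⟩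
  exact h _ r hr he

lemma informedSet_eq_of_single_tick (G : GossipModel μ N lamC lamR sigma) (j : Fin N)
    {t' a b τ : ℝ} (h0 : 0 ≤ a) (ht' : t' ≤ a) (hτ : τ ∈ Ioc a b) {ω : Ω} {c : GossipClock N}
    (h : ∀ c', ∀ r ∈ Ioc a b, r ∈ G.ticks c' ω ↔ c' = c ∧ r = τ) :
    G.informedSet j t' b ω = gossipUpdate j c (G.informedSet j t' a ω) := by
  classical
  -- Nothing happens in `(τ, b]`, so the set at `b` is the set just after `τ`.
  rw [G.informedSet_eq_of_no_tick j (h0.trans hτ.1.le) hτ.2 (fun c' r hr hr' =>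
    hr.1.ne' ((h c' r ⟨hτ.1.trans hr.1, hr.2⟩).1 hr').2)]
  have hr : ∀ i, ∀ r ∈ Ioo a τ, r ∉ (G.events ω).repl i := fun i r hr hr' =>
    hr.2.ne ((h _ r ⟨hr.1, hr.2.le.trans hτ.2⟩).1 hr').2
  have he : ∀ i k, ∀ r ∈ Ioo a τ, r ∉ (G.events ω).exch k i := by
    rintro i k r hr ⟨e, -, he⟩
    exact hr.2.ne ((h _ r ⟨hr.1, hr.2.le.trans hτ.2⟩).1 he).2
  ext i
  rw [mem_informedSet]
  have hjS := Finset.insert_eq_of_mem (G.self_mem_informedSet j t' a ω)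
  cases c with
  | repl i₀ =>
    rw [informed_iff_of_repl (i₀ := i₀) h0 hτ.1 hr he]
    · rw [gossipUpdate, hjS, Finset.mem_insert, Finset.mem_erase, mem_informedSet]
    · intro i
      refine (h (.repl i) τ hτ).trans ?_
      simp
    · rintro i k ⟨e, -, he⟩
      cases ((h _ τ hτ).1 he).1
  | pair e =>
    rw [informed_iff_of_exch (e := e.1) h0 ht' hτ.1 hr he]
    · rw [gossipUpdate, hjS, Finset.mem_filter]
      simp only [mem_informedSet, Finset.mem_univ, true_and]
    · intro i hi
      cases ((h (.repl i) τ hτ).1 hi).1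
    · intro i k
      constructor
      · rintro ⟨e', he', hτ'⟩
        have := ((h _ τ hτ).1 hτ').1
        rw [GossipClock.pair.injEq] at this
        rw [← this, he']
      · intro he'
        exact ⟨e, he', (h _ τ hτ).2 ⟨rfl, rfl⟩⟩

/-- As long as no two ticks happen in the same interval of the mesh, the set of informed agents
is given by the chain driven by the counts. -/
lemma informedSet_eq_countChain (G : GossipModel μ N lamC lamR sigma) (j : Fin N) {v : ℕ → ℝ}
    (hv : Monotone v) (h0 : 0 ≤ v 0) {ω : Ω} (q : ℕ)
    (h : ∀ p < q, ω ∉ multipleTicks (G.meshCount v) p) :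
    G.informedSet j (v 0) (v q) ω = countChain (gossipUpdate j) (G.meshCount v) {j} q ω := by
  induction q with
  | zero => exact G.informedSet_self j (v 0) ω
  | succ q ih =>
    rw [countChain, ← ih fun p hp => h p (hp.trans (Nat.lt_succ_self q))]
    have hq : 0 ≤ v q := h0.trans (hv (Nat.zero_le q))
    have hle : v q ≤ v (q + 1) := hv (Nat.le_succ q)
    rcases not_not.1 (h q (Nat.lt_succ_self q)) with hz | ⟨c, hc⟩
    · rw [hz, singleUpdate_zero]
      refine G.informedSet_eq_of_no_tick j hq hle fun c r hr hrc => ?_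
      have h1 : (G.ticks c ω ∩ Ioc (v q) (v (q + 1))).ncard = 0 := congrFun hz c
      rw [Set.ncard_eq_zero (G.ticks_inter_finite c _ _ ω)] at h1
      exact (h1 ▸ (⟨hrc, hr⟩ : r ∈ G.ticks c ω ∩ Ioc (v q) (v (q + 1))) : r ∈ (∅ : Set ℝ))
    · rw [hc, singleUpdate_single]
      have h1 : (G.ticks c ω ∩ Ioc (v q) (v (q + 1))).ncard = 1 := by
        have := congrFun hc c
        rwa [Pi.single_eq_same] at this
      obtain ⟨τ, hτ⟩ := Set.ncard_eq_one.1 h1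
      have hτ' : τ ∈ G.ticks c ω ∩ Ioc (v q) (v (q + 1)) := hτ ▸ Set.mem_singleton τ
      refine G.informedSet_eq_of_single_tick j hq (hv (Nat.zero_le q)) hτ'.2 fun c' r hr => ?_
      by_cases hcc : c' = c
      · subst hcc
        have : r ∈ G.ticks c' ω ∩ Ioc (v q) (v (q + 1)) ↔ r ∈ ({τ} : Set ℝ) := by rw [hτ]
        simp only [Set.mem_inter_iff, hr, and_true, Set.mem_singleton_iff] at this
        simp [this]
      · have h2 : (G.ticks c' ω ∩ Ioc (v q) (v (q + 1))).ncard = 0 := by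
          have := congrFun hc c'
          rwa [Pi.single_eq_of_ne hcc] at this
        rw [Set.ncard_eq_zero (G.ticks_inter_finite c' _ _ ω)] at h2
        simp only [hcc, false_and, iff_false]
        intro hrc
        exact (h2 ▸ (⟨hrc, hr⟩ : r ∈ G.ticks c' ω ∩ Ioc (v q) (v (q + 1))) : r ∈ (∅ : Set ℝ))

end GossipModel

end Mesh

/-! ### Matrix exponential as a limit of Euler products -/

section ExpLimit

/-- Telescoping estimate. Bounding both norms by `e^m` keeps the constant `e^{nm}` under control as
long as `n m` stays bounded. -/
lemma norm_pow_sub_pow_le_exp {𝔸 : Type*} [NormedRing 𝔸] [NormOneClass 𝔸] {a b : 𝔸} {m : ℝ}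
    (hm : 0 ≤ m) (ha : ‖a‖ ≤ Real.exp m) (hb : ‖b‖ ≤ Real.exp m) (n : ℕ) :
    ‖a ^ n - b ^ n‖ ≤ n * Real.exp (n * m) * ‖a - b‖ := by
  induction n with
  | zero => simp
  | succ n ih =>
    have h1 : a ^ (n + 1) - b ^ (n + 1) = a * (a ^ n - b ^ n) + (a - b) * b ^ n := by
      rw [pow_succ', pow_succ']
      noncomm_ring
    have hbn : ‖b ^ n‖ ≤ Real.exp (n * m) := by
      rw [Real.exp_nat_mul]
      exact (norm_pow_le b n).trans (pow_le_pow_left₀ (norm_nonneg b) hb n)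
    have h2 : Real.exp (n * m) ≤ Real.exp ((n + 1 : ℕ) * m) := by
      gcongr
      simp
    have h3 : Real.exp ((n + 1 : ℕ) * m) = Real.exp m * Real.exp (n * m) := by
      rw [← Real.exp_add]
      push_cast
      ring_nf
    calc ‖a ^ (n + 1) - b ^ (n + 1)‖
        ≤ ‖a‖ * ‖a ^ n - b ^ n‖ + ‖a - b‖ * ‖b ^ n‖ := by
          rw [h1]
          exact (norm_add_le _ _).trans (add_le_add (norm_mul_le _ _) (norm_mul_le _ _))
      _ ≤ Real.exp m * (n * Real.exp (n * m) * ‖a - b‖) +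
          ‖a - b‖ * Real.exp ((n + 1 : ℕ) * m) := by
          gcongr
          exact hbn.trans h2
      _ = (n + 1 : ℕ) * Real.exp ((n + 1 : ℕ) * m) * ‖a - b‖ := by
          rw [h3]
          push_cast
          ring

/-- `(1 + xₙ) ^ n → exp y` as soon as `n xₙ → y`, in a Banach algebra. -/
lemma tendsto_one_add_pow_exp {𝔸 : Type*} [NormedRing 𝔸] [NormOneClass 𝔸] [NormedAlgebra ℝ 𝔸]
    [NormedAlgebra ℚ 𝔸] [CompleteSpace 𝔸] {x : ℕ → 𝔸} {y : 𝔸}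
    (h : Tendsto (fun n : ℕ => (n : ℝ) • x n) atTop (𝓝 y)) :
    Tendsto (fun n => (1 + x n) ^ n) atTop (𝓝 (NormedSpace.exp y)) := by
  have hpow : ∀ n : ℕ, NormedSpace.exp ((n : ℝ) • x n) = NormedSpace.exp (x n) ^ n := by
    intro n
    rw [Nat.cast_smul_eq_nsmul, NormedSpace.exp_nsmul]
  have hexp : Tendsto (fun n => NormedSpace.exp (x n) ^ n) atTop (𝓝 (NormedSpace.exp y)) := by
    simp_rw [← hpow]
    exact h.exp
  have hx : Tendsto x atTop (𝓝 0) := by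
    have h1 := (tendsto_inv_atTop_nhds_zero_nat (𝕜 := ℝ)).smul h
    rw [zero_smul] at h1
    refine h1.congr' ?_
    filter_upwards [eventually_ge_atTop 1] with n hn
    rw [smul_smul, inv_mul_cancel₀ (by positivity), one_smul]
  -- First-order expansion of the exponential at `0`; multiplied by `n`, the remainder still
  -- vanishes because `n xₙ` converges.
  have hrem : (fun n => NormedSpace.exp (x n) - (1 + x n)) =o[atTop] x := by
    have h1 := (hasFDerivAt_exp_zero (𝕂 := ℝ) (𝔸 := 𝔸)).isLittleO
    have h2 := h1.comp_tendsto hx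
    refine (h2.congr (fun n => ?_) fun n => ?_)
    · simp [sub_sub]
    · simp
  have hnrem : Tendsto (fun n : ℕ => (n : ℝ) * ‖NormedSpace.exp (x n) - (1 + x n)‖) atTop
      (𝓝 0) := by
    have h1 : (fun n : ℕ => (n : ℝ) • (NormedSpace.exp (x n) - (1 + x n))) =o[atTop]
        fun n : ℕ => (n : ℝ) • x n := (Asymptotics.isBigO_refl _ _).smul_isLittleO hrem
    have h2 := (h1.trans_isBigO (h.isBigO_one ℝ)).tendsto_inv_smul_nhds_zero
    have h3 := h2.norm
    simpa [norm_smul] using h3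
  obtain ⟨M, hM⟩ : ∃ M, ∀ᶠ n : ℕ in atTop, ‖(n : ℝ) • x n‖ ≤ M :=
    ⟨‖y‖ + 1, (h.norm.eventually (Iic_mem_nhds (lt_add_one ‖y‖)))⟩
  have hdiff : Tendsto (fun n => (1 + x n) ^ n - NormedSpace.exp (x n) ^ n) atTop (𝓝 0) := by
    have hlim := hnrem.const_mul (Real.exp (M + 1))
    rw [mul_zero] at hlim
    refine squeeze_zero_norm' ?_ hlim
    filter_upwards [hM, hnrem.eventually (Iic_mem_nhds zero_lt_one)] with n hn hn'
    set ρ := ‖NormedSpace.exp (x n) - (1 + x n)‖ with hρ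
    have hρ0 : 0 ≤ ρ := norm_nonneg _
    have h1 : ‖1 + x n‖ ≤ 1 + ‖x n‖ := (norm_add_le _ _).trans (by rw [norm_one])
    have h2 := Real.add_one_le_exp (‖x n‖ + ρ)
    have h3 : ‖NormedSpace.exp (x n)‖ ≤ ρ + ‖1 + x n‖ := norm_le_norm_sub_add _ _
    -- This `m` serves both elements: each norm is at most `1 + ‖x n‖ + ρ ≤ e^{‖x n‖ + ρ}`, and `n
    -- m` is eventually at most `M + 1`.
    have hb := norm_pow_sub_pow_le_exp (a := 1 + x n) (b := NormedSpace.exp (x n))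
      (m := ‖x n‖ + ρ) (by positivity) (by linarith) (by linarith) n
    rw [norm_sub_rev (1 + x n), ← hρ] at hb
    refine hb.trans ?_
    have h4 : (n : ℝ) * (‖x n‖ + ρ) ≤ M + 1 := by
      rw [norm_smul, Real.norm_natCast] at hn
      rw [mul_add]
      exact add_le_add hn hn'
    calc (n : ℝ) * Real.exp (n * (‖x n‖ + ρ)) * ρ ≤ n * Real.exp (M + 1) * ρ := by gcongr
      _ = Real.exp (M + 1) * (n * ρ) := by ring
  simpa using hdiff.add hexp

/-- Euler scheme for `exp (s • Q)` with the steps of Poisson clocks of total rate `R`. -/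
lemma tendsto_euler_exp {n : ℕ} (Q : Matrix (Fin n) (Fin n) ℝ) (R s : ℝ) :
    Tendsto (fun m : ℕ => (1 + ((s / m) * Real.exp (-(R * (s / m)))) • Q) ^ m) atTop
      (𝓝 (NormedSpace.exp (s • Q))) := by
  -- The identity matrix has norm `1` only for a nonempty index type, so size `0` is treated apart.
  rcases n with - | n
  · exact tendsto_const_nhds.congr fun _ => Subsingleton.elim _ _
  let _ : NormedRing (Matrix (Fin (n + 1)) (Fin (n + 1)) ℝ) := Matrix.linftyOpNormedRing
  let _ : NormedAlgebra ℝ (Matrix (Fin (n + 1)) (Fin (n + 1)) ℝ) := Matrix.linftyOpNormedAlgebra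
  let _ : NormedAlgebra ℚ (Matrix (Fin (n + 1)) (Fin (n + 1)) ℝ) :=
    NormedAlgebra.restrictScalars ℚ ℝ _
  have _ : NormOneClass (Matrix (Fin (n + 1)) (Fin (n + 1)) ℝ) := Matrix.linfty_opNormOneClass
  refine tendsto_one_add_pow_exp ?_
  have h0 : Tendsto (fun m : ℕ => s / (m : ℝ)) atTop (𝓝 0) :=
    tendsto_const_nhds.div_atTop tendsto_natCast_atTop_atTop
  have h1 : Tendsto (fun m : ℕ => (s * Real.exp (-(R * (s / m)))) • Q) atTop
      (𝓝 ((s * Real.exp (-(R * 0))) • Q)) :=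
    (((Real.continuous_exp.tendsto _).comp (h0.const_mul R).neg).const_mul s).smul_const Q
  rw [mul_zero, neg_zero, Real.exp_zero, mul_one] at h1
  refine h1.congr' ?_
  filter_upwards [eventually_ge_atTop 1] with m hm
  have : (m : ℝ) ≠ 0 := by positivity
  rw [smul_smul]
  congr 1
  field_simp

lemma hasDerivAt_exp_smul {n : ℕ} (Q : Matrix (Fin n) (Fin n) ℝ) (s : ℝ) :
    HasDerivAt (fun s : ℝ => NormedSpace.exp (s • Q)) (Q * NormedSpace.exp (s • Q)) s := by
  let _ : NormedRing (Matrix (Fin n) (Fin n) ℝ) := Matrix.linftyOpNormedRing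
  let _ : NormedAlgebra ℝ (Matrix (Fin n) (Fin n) ℝ) := Matrix.linftyOpNormedAlgebra
  exact hasDerivAt_exp_smul_const' Q s

end ExpLimit

/-! ### Finite-dimensional distributions of the chain driven by the counts -/

section FiniteDim

variable {Ω : Type*} [mΩ : MeasurableSpace Ω] {μ : Measure Ω} {N : ℕ} {lamC lamR : ℝ≥0}
  {T : GossipClock N → ℕ → Ω → ℕ} {h : ℕ → ℝ}

/-- The total rate of the clocks. -/
noncomputable def totalRate (N : ℕ) (lamC lamR : ℝ≥0) : ℝ :=
  ∑ c : GossipClock N, clockRate N lamC lamR c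

/-- The generator of the number of informed agents. -/
noncomputable abbrev gossipGenerator (N : ℕ) (lamC lamR : ℝ≥0) : Matrix (Fin N) (Fin N) ℝ :=
  birthDeathGenerator N (gossipBirth N lamC) (gossipDeath lamR)

/-- The transition matrix of the number of informed agents in a step of length `h`. -/
noncomputable def stepMatrix (N : ℕ) (lamC lamR : ℝ≥0) (h : ℝ) : Matrix (Fin N) (Fin N) ℝ :=
  1 + (h * Real.exp (-(totalRate N lamC lamR * h))) • gossipGenerator N lamC lamR

lemma abs_cardIndicator_le (j k : Fin N) (B : Finset (Fin N)) : |cardIndicator j k B| ≤ 1 := by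
  unfold cardIndicator
  split_ifs <;> simp

/-- By lumping, the one-step identity closes into a linear recursion with no error term. The weight
`Y` carries the past, as needed for joint laws. -/
lemma integral_cardIndicator_succ [IsProbabilityMeasure μ]
    (hT : PoissonCounts μ T (clockRate N lamC lamR) h) (j k : Fin N) (q : ℕ) {Y : Ω → ℝ}
    (hY : Measurable[countPast T q] Y) (hb : ∀ ω, |Y ω| ≤ 1) :
    ∫ ω, Y ω * cardIndicator j k (countChain (gossipUpdate j) T {j} (q + 1) ω) ∂μ =
      ∑ c, stepMatrix N lamC lamR (h q) k c *
        ∫ ω, Y ω * cardIndicator j c (countChain (gossipUpdate j) T {j} q ω) ∂μ := by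
  have hint : ∀ c, Integrable (fun ω => Y ω *
      cardIndicator j c (countChain (gossipUpdate j) T {j} q ω)) μ := by
    intro c
    have hm : Measurable[countPast T q] fun ω => Y ω *
        cardIndicator j c (countChain (gossipUpdate j) T {j} q ω) :=
      hY.mul ((Measurable.of_discrete (f := cardIndicator j c)).comp
        (measurable_countChain (gossipUpdate j) {j} q))
    refine Integrable.of_bound (hm.mono (hT.countPast_le q) le_rfl).aestronglyMeasurable 1
      (ae_of_all _ fun ω => ?_)
    rw [Real.norm_eq_abs, abs_mul]
    exact mul_le_one₀ (hb ω) (abs_nonneg _) (abs_cardIndicator_le j c _)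
  rw [hT.integral_countChain_succ (gossipUpdate j) {j} q hY hb (cardIndicator j k)]
  simp_rw [updateGenerator_cardIndicator, Finset.mul_sum]
  rw [integral_finsetSum]
  · have : ∀ c ω, Y ω * (gossipGenerator N lamC lamR k c *
        cardIndicator j c (countChain (gossipUpdate j) T {j} q ω)) =
        gossipGenerator N lamC lamR k c *
          (Y ω * cardIndicator j c (countChain (gossipUpdate j) T {j} q ω)) :=
      fun c ω => by ring
    simp_rw [this, integral_const_mul]
    simp only [stepMatrix, Matrix.add_apply, Matrix.smul_apply, smul_eq_mul, add_mul,
      Finset.sum_add_distrib, Matrix.one_apply, ite_mul, one_mul, zero_mul, Finset.sum_ite_eq,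
      Finset.mem_univ, if_true, totalRate, Finset.mul_sum, mul_assoc]
  · intro c _
    refine ((hint c).const_mul (gossipGenerator N lamC lamR k c)).congr (ae_of_all _ fun ω => ?_)
    ring

lemma integral_cardIndicator_add [IsProbabilityMeasure μ]
    (hT : PoissonCounts μ T (clockRate N lamC lamR) h) (j : Fin N) (q r : ℕ) {δ : ℝ}
    (hδ : ∀ p < r, h (q + p) = δ) {Y : Ω → ℝ}
    (hY : Measurable[countPast T q] Y) (hb : ∀ ω, |Y ω| ≤ 1) (k : Fin N) :
    ∫ ω, Y ω * cardIndicator j k (countChain (gossipUpdate j) T {j} (q + r) ω) ∂μ =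
      ∑ c, (stepMatrix N lamC lamR δ ^ r) k c *
        ∫ ω, Y ω * cardIndicator j c (countChain (gossipUpdate j) T {j} q ω) ∂μ := by
  induction r generalizing k with
  | zero => simp [Matrix.one_apply]
  | succ r ih =>
    rw [← add_assoc, integral_cardIndicator_succ hT j k (q + r)
      (hY.mono (countPast_mono (Nat.le_add_right q r)) le_rfl) hb, hδ r (Nat.lt_succ_self r)]
    simp_rw [fun c => ih (fun p hp => hδ p (hp.trans (Nat.lt_succ_self r))) c]
    rw [pow_succ']
    simp_rw [Matrix.mul_apply, Finset.mul_sum, Finset.sum_mul]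
    rw [Finset.sum_comm]
    simp_rw [mul_assoc]

lemma cardIndicator_mul_cardIndicator (j k c : Fin N) (B : Finset (Fin N)) :
    cardIndicator j k B * cardIndicator j c B = if c = k then cardIndicator j k B else 0 := by
  unfold cardIndicator
  by_cases h1 : (insert j B).card = k + 1
  · by_cases h2 : c = k
    · simp [h1, h2]
    · have : ¬ ((k : ℕ) = c) := fun h => h2 (Fin.ext h.symm)
      simp [h1, h2, this]
  · simp [h1]

/-- The joint law of the number of informed agents at the times `0, n, 2n, …, mn`, if the steps
have the same length in each block of `n` steps. -/
lemma real_countChain_eq [IsProbabilityMeasure μ]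
    (hT : PoissonCounts μ T (clockRate N lamC lamR) h) (j : Fin N) (n : ℕ) (δ : ℕ → ℝ) (m : ℕ)
    (hδ : ∀ l < m, ∀ p < n, h (n * l + p) = δ l) (k : ℕ → Fin N) :
    μ.real {ω | ∀ l ≤ m,
        (insert j (countChain (gossipUpdate j) T {j} (n * l) ω)).card = k l + 1} =
      (if (k 0 : ℕ) + 1 = 1 then 1 else 0) *
        ∏ l ∈ Finset.range m, (stepMatrix N lamC lamR (δ l) ^ n) (k (l + 1)) (k l) := by
  let X : ℕ → Ω → Finset (Fin N) := countChain (gossipUpdate j) T {j}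
  -- `Y m` is the indicator of the prescribed states at the first `m + 1` observation times. It
  -- already forces state `k m`, so the sum over intermediate states reduces to one term: the Markov
  -- property.
  let Y : ℕ → Ω → ℝ := fun m ω => ∏ l ∈ Finset.range (m + 1), cardIndicator j (k l) (X (n * l) ω)
  have hYm : ∀ m, Measurable[countPast T (n * m)] (Y m) := fun m => by
    refine Finset.measurable_prod _ fun l hl => ?_
    have hl' : l ≤ m := Nat.lt_succ_iff.1 (Finset.mem_range.1 hl)
    exact ((Measurable.of_discrete (f := cardIndicator j (k l))).comp
      (measurable_countChain (gossipUpdate j) {j} (n * l))).mono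
      (countPast_mono (Nat.mul_le_mul_left n hl')) le_rfl
  have hYb : ∀ m ω, |Y m ω| ≤ 1 := fun m ω => by
    rw [Finset.abs_prod]
    exact Finset.prod_le_one (fun _ _ => abs_nonneg _) fun l _ => abs_cardIndicator_le j _ _
  have hYset : ∀ m, Y m =
      Set.indicator {ω | ∀ l ≤ m, (insert j (X (n * l) ω)).card = k l + 1} 1 := by
    intro m
    ext ω
    simp only [Y, cardIndicator, Finset.prod_ite_zero, Finset.mem_range, Finset.prod_const_one,
      Nat.lt_succ_iff, Set.indicator_apply, Set.mem_ofPred_eq, Pi.one_apply]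
  have hms : MeasurableSet {ω | ∀ l ≤ m, (insert j (X (n * l) ω)).card = k l + 1} := by
    have : {ω | ∀ l ≤ m, (insert j (X (n * l) ω)).card = k l + 1} = Y m ⁻¹' {1} := by
      ext ω
      rw [hYset m]
      by_cases hω : ω ∈ {ω | ∀ l ≤ m, (insert j (X (n * l) ω)).card = k l + 1}
      · simp [hω]
      · simp [hω]
    rw [this]
    exact (hYm m).mono (hT.countPast_le _) le_rfl (measurableSet_singleton 1)
  have key : ∀ m, (∀ l < m, ∀ p < n, h (n * l + p) = δ l) → ∫ ω, Y m ω ∂μ =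
      (if (k 0 : ℕ) + 1 = 1 then 1 else 0) *
        ∏ l ∈ Finset.range m, (stepMatrix N lamC lamR (δ l) ^ n) (k (l + 1)) (k l) := by
    intro m
    induction m with
    | zero =>
      intro _
      have : ∀ ω, Y 0 ω = if (k 0 : ℕ) + 1 = 1 then 1 else 0 := by
        intro ω
        simp [Y, X, countChain, cardIndicator, eq_comm]
      simp [this]
    | succ m ih =>
      intro hδ
      have h1 : ∀ ω, Y (m + 1) ω = Y m ω * cardIndicator j (k (m + 1)) (X (n * m + n) ω) := by
        intro ω
        simp only [Y]
        rw [Finset.prod_range_succ _ (m + 1), Nat.mul_succ]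
      have h2 : ∀ c ω, Y m ω * cardIndicator j c (X (n * m) ω) =
          if c = k m then Y m ω else 0 := by
        intro c ω
        simp only [Y]
        rw [Finset.prod_range_succ, mul_assoc, cardIndicator_mul_cardIndicator]
        split_ifs <;> simp
      simp_rw [h1]
      rw [integral_cardIndicator_add hT j (n * m) n (hδ m (Nat.lt_succ_self m)) (hYm m) (hYb m)]
      rw [Finset.sum_eq_single (k m)]
      · simp_rw [X] at h2
        simp_rw [h2, if_true]
        rw [ih fun l hl => hδ l (hl.trans (Nat.lt_succ_self m)), Finset.prod_range_succ]
        ring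
      · intro c _ hc
        simp_rw [X] at h2
        simp [h2, hc]
      · simp
  rw [← key m hδ, hYset m, integral_indicator_one hms]

/-- Relabelling the agents other than `j` does not change the law of the set of informed agents. -/
lemma integral_countChain_map [IsProbabilityMeasure μ]
    (hT : PoissonCounts μ T (clockRate N lamC lamR) h) (j : Fin N) (σ : Equiv.Perm (Fin N))
    (hσ : σ j = j) (q : ℕ) (g : Finset (Fin N) → ℝ) :
    ∫ ω, g ((countChain (gossipUpdate j) T {j} q ω).map σ.toEmbedding) ∂μ =
      ∫ ω, g (countChain (gossipUpdate j) T {j} q ω) ∂μ := by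
  induction q generalizing g with
  | zero => simp [countChain, hσ]
  | succ q ih =>
    have h1 := fun g : Finset (Fin N) → ℝ => hT.integral_countChain_succ (gossipUpdate j) {j} q
      (Y := fun _ => 1) measurable_const (by simp) g
    simp only [one_mul] at h1
    -- The induction hypothesis is needed for `g` and for its image under the generator, hence the
    -- generalization over `g`.
    rw [h1 g, h1 fun B => g (B.map σ.toEmbedding), ih]
    simp_rw [updateGenerator_map lamC lamR j σ hσ]
    rw [ih]

/-- The probability that agent `i` is informed in terms of the law of the number of informed
agents. -/
lemma real_mem_countChain [IsProbabilityMeasure μ] (hN : 2 ≤ N)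
    (hT : PoissonCounts μ T (clockRate N lamC lamR) h) {j i : Fin N} (hij : i ≠ j) (n : ℕ) {δ : ℝ}
    (hδ : ∀ p < n, h p = δ) :
    μ.real {ω | i ∈ countChain (gossipUpdate j) T {j} n ω} =
      gossipW N ⬝ᵥ (stepMatrix N lamC lamR δ ^ n).mulVec (gossipE1 N) := by
  classical
  let X : Ω → Finset (Fin N) := countChain (gossipUpdate j) T {j} n
  have hX : Measurable X := (measurable_countChain (gossipUpdate j) {j} n).mono
    (hT.countPast_le n) le_rfl
  have hint : ∀ f : Finset (Fin N) → ℝ, Integrable (fun ω => f (X ω)) μ := by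
    intro f
    obtain ⟨C, hC⟩ := (Set.finite_range fun B => ‖f B‖).bddAbove
    exact Integrable.of_bound ((Measurable.of_discrete (f := f)).comp hX).aestronglyMeasurable C
      (ae_of_all _ fun ω => hC ⟨_, rfl⟩)
  let g : Fin N → Finset (Fin N) → ℝ := fun i B => if i ∈ B then 1 else 0
  have hp : ∀ i, μ.real {ω | i ∈ X ω} = ∫ ω, g i (X ω) ∂μ := by
    intro i
    have hs : MeasurableSet {ω | i ∈ X ω} := hX (t := {B | i ∈ B}) .of_discrete
    rw [← integral_indicator_one hs]
    refine integral_congr_ae (ae_of_all _ fun ω => ?_)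
    simp [g, Set.indicator_apply]
  -- Swapping `i` and `i'` fixes `j`, so all agents other than `j` are equally likely to be
  -- informed; this is the origin of the weights `w`.
  have hsymm : ∀ i', i' ≠ j → ∫ ω, g i' (X ω) ∂μ = ∫ ω, g i (X ω) ∂μ := by
    intro i' hi'
    rw [← integral_countChain_map hT j (Equiv.swap i i')
      (Equiv.swap_apply_of_ne_of_ne hij.symm hi'.symm) n (g i')]
    simp only [g, Finset.mem_map_equiv, Equiv.symm_swap, Equiv.swap_apply_right]
    rfl
  have hN1 : ((N : ℝ) - 1) ≠ 0 := by
    have : (2 : ℝ) ≤ N := by exact_mod_cast hN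
    linarith
  have hsum : ((N : ℝ) - 1) * ∫ ω, g i (X ω) ∂μ = ∫ ω, ((insert j (X ω)).card - 1 : ℝ) ∂μ := by
    have h1 : ∑ i' ∈ Finset.univ.erase j, ∫ ω, g i' (X ω) ∂μ =
        ((N : ℝ) - 1) * ∫ ω, g i (X ω) ∂μ := by
      rw [Finset.sum_congr rfl fun i' hi' => hsymm i' (Finset.ne_of_mem_erase hi'),
        Finset.sum_const, Finset.card_erase_of_mem (Finset.mem_univ j), Finset.card_fin,
        nsmul_eq_mul, Nat.cast_sub (by omega), Nat.cast_one]
    rw [← h1, ← integral_finsetSum _ fun i' _ => hint (g i')]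
    refine integral_congr_ae (ae_of_all _ fun ω => ?_)
    simp only [g]
    rw [← Finset.sum_filter, Finset.sum_const, nsmul_eq_mul, mul_one,
      ← Finset.card_erase_add_one (Finset.mem_insert_self j (X ω)), Nat.cast_add, Nat.cast_one,
      add_sub_cancel_right]
    congr 2
    ext a
    simp only [Finset.mem_filter, Finset.mem_erase, Finset.mem_univ, and_true, Finset.mem_insert]
    tauto
  have hcard : ∀ B : Finset (Fin N), ((insert j B).card - 1 : ℝ) =
      ∑ k : Fin N, (k : ℝ) * cardIndicator j k B := by
    intro B
    have hB : (insert j B).card ≤ N := by simpa using Finset.card_le_univ (insert j B)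
    have hB1 : 1 ≤ (insert j B).card := Finset.card_pos.2 ⟨j, Finset.mem_insert_self j B⟩
    obtain ⟨l, hl⟩ : ∃ l : Fin N, (insert j B).card = l + 1 :=
      ⟨⟨(insert j B).card - 1, by omega⟩, (Nat.sub_add_cancel hB1).symm⟩
    rw [Finset.sum_eq_single l]
    · simp [cardIndicator, hl]
    · intro c _ hc
      rw [cardIndicator, hl, if_neg, mul_zero]
      exact fun h => hc (Fin.ext (by omega))
    · simp
  have hk : ∀ k : Fin N, ∫ ω, cardIndicator j k (X ω) ∂μ =
      (stepMatrix N lamC lamR δ ^ n).mulVec (gossipE1 N) k := by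
    intro k
    have h1 := integral_cardIndicator_add hT j 0 n (δ := δ) (by simpa using hδ)
      (Y := fun _ => 1) measurable_const (by simp) k
    simp only [one_mul, zero_add] at h1
    refine h1.trans ?_
    simp only [Matrix.mulVec, dotProduct]
    refine Finset.sum_congr rfl fun c _ => ?_
    congr 1
    simp [countChain, cardIndicator, gossipE1]
  change μ.real {ω | i ∈ X ω} = _
  rw [hp, ← mul_right_inj' hN1, hsum]
  simp_rw [hcard]
  rw [integral_finsetSum _ fun k _ => (hint (cardIndicator j k)).const_mul _]
  simp_rw [integral_const_mul, hk, dotProduct, Finset.mul_sum, gossipW]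
  refine Finset.sum_congr rfl fun k _ => ?_
  field_simp
  ring

end FiniteDim

/-! ### Refining meshes -/

section Refine

/-- The mesh that starts at `t'` and cuts each interval `[t' + u l, t' + u (l + 1)]` into `n`
equal parts. -/
noncomputable def refinedMesh (t' : ℝ) (u : ℕ → ℝ) (n q : ℕ) : ℝ :=
  t' + u (q / n) + (q % n : ℕ) * ((u (q / n + 1) - u (q / n)) / n)

variable {t' : ℝ} {u : ℕ → ℝ} {n : ℕ}

lemma refinedMesh_add (hn : 0 < n) (l : ℕ) {r : ℕ} (hr : r ≤ n) :
    refinedMesh t' u n (n * l + r) = t' + u l + r * ((u (l + 1) - u l) / n) := by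
  have hn' : (n : ℝ) ≠ 0 := by positivity
  rcases hr.lt_or_eq with hr | rfl
  · rw [refinedMesh, Nat.mul_add_div hn, Nat.div_eq_of_lt hr, Nat.mul_add_mod,
      Nat.mod_eq_of_lt hr, add_zero]
  -- For `r = n` the index already belongs to the next block, whose left end point agrees with the
  -- formula.
  · rw [refinedMesh, ← Nat.mul_succ, Nat.mul_div_cancel_left _ hn, Nat.mul_mod_right]
    field_simp
    simp [mul_comm]

lemma refinedMesh_mul (hn : 0 < n) (l : ℕ) : refinedMesh t' u n (n * l) = t' + u l := by
  simpa using refinedMesh_add (t' := t') (u := u) hn l (Nat.zero_le n)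

lemma refinedMesh_step (hn : 0 < n) (l : ℕ) {r : ℕ} (hr : r < n) :
    refinedMesh t' u n (n * l + r + 1) - refinedMesh t' u n (n * l + r) =
      (u (l + 1) - u l) / n := by
  rw [add_assoc, refinedMesh_add hn l hr, refinedMesh_add hn l hr.le]
  push_cast
  ring

lemma refinedMesh_mono (hn : 0 < n) (hu : Monotone u) : Monotone (refinedMesh t' u n) := by
  refine monotone_nat_of_le_succ fun q => ?_
  have h := refinedMesh_step (t' := t') (u := u) hn (q / n) (Nat.mod_lt q hn)
  rw [Nat.div_add_mod] at h
  have : 0 ≤ (u (q / n + 1) - u (q / n)) / n :=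
    div_nonneg (sub_nonneg.2 (hu (Nat.le_succ _))) (Nat.cast_nonneg n)
  linarith

end Refine

/-! ### Passage to the limit along refined meshes -/

section Limit

variable {Ω : Type*} [mΩ : MeasurableSpace Ω] {μ : Measure Ω} {N : ℕ} {lamC lamR : ℝ≥0}
  {sigma : ℝ}

/-- Only monotonicity and subadditivity enter, so no measurability of `E` or `E'` is needed; this
matters for events defined through knowledge sets. -/
lemma abs_measureReal_sub_le [IsProbabilityMeasure μ] {E E' A : Set Ω}
    (h : ∀ ω ∉ A, ω ∈ E ↔ ω ∈ E') : |μ.real E - μ.real E'| ≤ μ.real A := by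
  have h1 : μ.real E ≤ μ.real E' + μ.real A := by
    refine (measureReal_mono fun ω hω => ?_).trans (measureReal_union_le _ _)
    by_cases hA : ω ∈ A
    · exact Or.inr hA
    · exact Or.inl ((h ω hA).1 hω)
  have h2 : μ.real E' ≤ μ.real E + μ.real A := by
    refine (measureReal_mono fun ω hω => ?_).trans (measureReal_union_le _ _)
    by_cases hA : ω ∈ A
    · exact Or.inr hA
    · exact Or.inl ((h ω hA).2 hω)
  rw [abs_le]
  constructor <;> linarith

namespace GossipModel

/-- The event that one of the intervals of the refined mesh before `t' + u m` has several ticks. -/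
def meshFailure (G : GossipModel μ N lamC lamR sigma) (t' : ℝ) (u : ℕ → ℝ) (m n : ℕ) : Set Ω :=
  ⋃ p ∈ Finset.range (n * m), multipleTicks (G.meshCount (refinedMesh t' u n)) p

variable {t' : ℝ} {u : ℕ → ℝ} {n : ℕ}

lemma poissonCounts_refinedMesh (G : GossipModel μ N lamC lamR sigma) (ht' : 0 ≤ t')
    (hu0 : u 0 = 0) (hu : Monotone u) (hn : 0 < n) :
    PoissonCounts μ (G.meshCount (refinedMesh t' u n)) (clockRate N lamC lamR)
      (fun q => refinedMesh t' u n (q + 1) - refinedMesh t' u n q) := by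
  refine G.poissonCounts (refinedMesh_mono hn hu) ?_
  have := refinedMesh_mul (t' := t') (u := u) hn 0
  rw [mul_zero, hu0, add_zero] at this
  rwa [this]

lemma informedSet_eq_of_notMem_meshFailure (G : GossipModel μ N lamC lamR sigma) (j : Fin N)
    (ht' : 0 ≤ t') (hu0 : u 0 = 0) (hu : Monotone u) (hn : 0 < n) {m : ℕ} {ω : Ω}
    (hω : ω ∉ G.meshFailure t' u m n) {l : ℕ} (hl : l ≤ m) :
    G.informedSet j t' (t' + u l) ω =
      countChain (gossipUpdate j) (G.meshCount (refinedMesh t' u n)) {j} (n * l) ω := by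
  have h0 := refinedMesh_mul (t' := t') (u := u) hn 0
  rw [mul_zero, hu0, add_zero] at h0
  have h := G.informedSet_eq_countChain j (refinedMesh_mono (t' := t') hn hu) (by rw [h0]; exact ht') (ω := ω)
    (n * l) fun p hp hp' => hω (Set.mem_iUnion₂.2
      ⟨p, Finset.mem_range.2 (hp.trans_le (Nat.mul_le_mul_left n hl)), hp'⟩)
  rwa [h0, refinedMesh_mul hn] at h

/-- Each of the `n m` intervals has length at most `u m / n` and fails with probability quadratic in
that length; summing leaves one factor `1 / n`. -/
lemma real_meshFailure_le [IsProbabilityMeasure μ] (G : GossipModel μ N lamC lamR sigma)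
    (ht' : 0 ≤ t') (hu0 : u 0 = 0) (hu : Monotone u) (hn : 0 < n) (m : ℕ) :
    μ.real (G.meshFailure t' u m n) ≤ m * (totalRate N lamC lamR * u m) ^ 2 / n := by
  have hT := G.poissonCounts_refinedMesh ht' hu0 hu hn
  have hR : 0 ≤ totalRate N lamC lamR := Finset.sum_nonneg fun c _ => hT.rate_nonneg c
  have hn' : (0 : ℝ) < n := by exact_mod_cast hn
  have hp : ∀ p ∈ Finset.range (n * m),
      μ.real (multipleTicks (G.meshCount (refinedMesh t' u n)) p) ≤
        (totalRate N lamC lamR * (u m / n)) ^ 2 := by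
    intro p hp
    refine (hT.real_multipleTicks_le p).trans ?_
    have hstep := refinedMesh_step (t' := t') (u := u) hn (p / n) (Nat.mod_lt p hn)
    rw [Nat.div_add_mod] at hstep
    have hlt : p / n < m := Nat.div_lt_of_lt_mul (Finset.mem_range.1 hp)
    have h1 : u (p / n + 1) ≤ u m := hu hlt
    have h2 : 0 ≤ u (p / n) := hu0 ▸ hu (Nat.zero_le _)
    refine pow_le_pow_left₀ (mul_nonneg hR (hT.step_nonneg p))
      (mul_le_mul_of_nonneg_left ?_ hR) 2
    rw [hstep]
    gcongr
    linarith
  calc μ.real (G.meshFailure t' u m n)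
      ≤ ∑ p ∈ Finset.range (n * m),
          μ.real (multipleTicks (G.meshCount (refinedMesh t' u n)) p) :=
        measureReal_biUnion_finset_le _ _
    _ ≤ ∑ p ∈ Finset.range (n * m), (totalRate N lamC lamR * (u m / n)) ^ 2 :=
        Finset.sum_le_sum hp
    _ = m * (totalRate N lamC lamR * u m) ^ 2 / n := by
        rw [Finset.sum_const, Finset.card_range, nsmul_eq_mul]
        push_cast
        field_simp

lemma tendsto_real_meshFailure [IsProbabilityMeasure μ] (G : GossipModel μ N lamC lamR sigma)
    (ht' : 0 ≤ t') (hu0 : u 0 = 0) (hu : Monotone u) (m : ℕ) :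
    Tendsto (fun n => μ.real (G.meshFailure t' u m n)) atTop (𝓝 0) := by
  have h : Tendsto (fun n : ℕ => m * (totalRate N lamC lamR * u m) ^ 2 / (n : ℝ)) atTop (𝓝 0) :=
    tendsto_const_nhds.div_atTop tendsto_natCast_atTop_atTop
  refine squeeze_zero' (Eventually.of_forall fun _ => measureReal_nonneg) ?_ h
  filter_upwards [eventually_gt_atTop 0] with n hn
  exact G.real_meshFailure_le ht' hu0 hu hn m

/-- The finite-dimensional distributions of the number of informed agents. -/
lemma real_card_informedSet [IsProbabilityMeasure μ] (G : GossipModel μ N lamC lamR sigma)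
    (j : Fin N) (ht' : 0 ≤ t') (hu0 : u 0 = 0) (hu : Monotone u) (m : ℕ) (k : ℕ → Fin N) :
    μ.real {ω | ∀ l ≤ m, (G.informedSet j t' (t' + u l) ω).card = k l + 1} =
      (if (k 0 : ℕ) + 1 = 1 then 1 else 0) * ∏ l ∈ Finset.range m,
        NormedSpace.exp ((u (l + 1) - u l) • gossipGenerator N lamC lamR) (k (l + 1)) (k l) := by
  have h1 : Tendsto (fun n : ℕ => (if (k 0 : ℕ) + 1 = 1 then (1 : ℝ) else 0) *
      ∏ l ∈ Finset.range m,
        (stepMatrix N lamC lamR ((u (l + 1) - u l) / n) ^ n) (k (l + 1)) (k l)) atTop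
      (𝓝 ((if (k 0 : ℕ) + 1 = 1 then 1 else 0) * ∏ l ∈ Finset.range m,
        NormedSpace.exp ((u (l + 1) - u l) • gossipGenerator N lamC lamR)
          (k (l + 1)) (k l))) := by
    refine (tendsto_finsetProd _ fun l _ => ?_).const_mul _
    exact ((tendsto_euler_exp (gossipGenerator N lamC lamR) (totalRate N lamC lamR)
      (u (l + 1) - u l)).apply_nhds (k (l + 1))).apply_nhds (k l)
  -- The left side does not depend on the mesh; it differs from the law of the discrete chain by at
  -- most the failure probability, so both have the same limit.
  refine tendsto_nhds_unique (l := (atTop : Filter ℕ)) (f := fun _ : ℕ =>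
    μ.real {ω | ∀ l ≤ m, (G.informedSet j t' (t' + u l) ω).card = k l + 1})
    tendsto_const_nhds ?_
  have h2 := G.tendsto_real_meshFailure ht' hu0 hu m
  refine (tendsto_iff_of_dist ?_).1 h1
  refine squeeze_zero' (Eventually.of_forall fun _ => dist_nonneg) ?_ h2
  filter_upwards [eventually_gt_atTop 0] with n hn
  rw [← real_countChain_eq (G.poissonCounts_refinedMesh ht' hu0 hu hn) j n
    (fun l => (u (l + 1) - u l) / n) m (fun l _ p hp => refinedMesh_step hn l hp) k,
    Real.dist_eq]
  refine abs_measureReal_sub_le fun ω hω => ?_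
  refine forall₂_congr fun l hl => ?_
  rw [← G.informedSet_eq_of_notMem_meshFailure j ht' hu0 hu hn hω hl,
    Finset.insert_eq_of_mem (G.self_mem_informedSet j t' _ ω)]

/-- The times `0, s, s, …`. -/
def twoTimes (s : ℝ) (l : ℕ) : ℝ := if l = 0 then 0 else s

lemma twoTimes_mono {s : ℝ} (hs : 0 ≤ s) : Monotone (twoTimes s) := by
  refine monotone_nat_of_le_succ fun l => ?_
  by_cases h : l = 0 <;> simp [twoTimes, h, hs]

/-- The probability that agent `i` is informed. -/
lemma real_mem_informedSet [IsProbabilityMeasure μ] (G : GossipModel μ N lamC lamR sigma)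
    (hN : 2 ≤ N) {j i : Fin N} (hij : i ≠ j) (ht' : 0 ≤ t') {s : ℝ} (hs : 0 ≤ s) :
    μ.real {ω | i ∈ G.informedSet j t' (t' + s) ω} =
      gossipW N ⬝ᵥ
        (NormedSpace.exp (s • gossipGenerator N lamC lamR)).mulVec (gossipE1 N) := by
  have hu := twoTimes_mono hs
  have hu0 : twoTimes s 0 = 0 := rfl
  have h1 : Tendsto (fun n : ℕ => gossipW N ⬝ᵥ
      (stepMatrix N lamC lamR (s / n) ^ n).mulVec (gossipE1 N)) atTop
      (𝓝 (gossipW N ⬝ᵥ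
        (NormedSpace.exp (s • gossipGenerator N lamC lamR)).mulVec (gossipE1 N))) := by
    have hc : Continuous fun M : Matrix (Fin N) (Fin N) ℝ =>
        gossipW N ⬝ᵥ M.mulVec (gossipE1 N) := by fun_prop
    exact (hc.tendsto _).comp (tendsto_euler_exp _ _ s)
  refine tendsto_nhds_unique (l := (atTop : Filter ℕ)) (f := fun _ : ℕ =>
    μ.real {ω | i ∈ G.informedSet j t' (t' + s) ω}) tendsto_const_nhds ?_
  have h2 := G.tendsto_real_meshFailure ht' hu0 hu 1
  refine (tendsto_iff_of_dist ?_).1 h1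
  refine squeeze_zero' (Eventually.of_forall fun _ => dist_nonneg) ?_ h2
  filter_upwards [eventually_gt_atTop 0] with n hn
  rw [← real_mem_countChain hN (G.poissonCounts_refinedMesh ht' hu0 hu hn) hij n
    (fun p hp => ?_), Real.dist_eq]
  · refine abs_measureReal_sub_le fun ω hω => ?_
    have := G.informedSet_eq_of_notMem_meshFailure j ht' hu0 hu hn hω le_rfl
    rw [mul_one] at this
    rw [Set.mem_ofPred_eq, Set.mem_ofPred_eq, ← this]
    rfl
  · have := refinedMesh_step (t' := t') (u := twoTimes s) hn 0 hp
    simpa [twoTimes] using this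

/-- The count is an almost sure limit of measurable ones: along meshes with `2 ^ n` steps the
failure probabilities are summable, so by Borel–Cantelli the discrete chain is eventually exact. -/
lemma aemeasurable_card_informedSet [IsProbabilityMeasure μ]
    (G : GossipModel μ N lamC lamR sigma) (j : Fin N) (ht' : 0 ≤ t') {s : ℝ} (hs : 0 ≤ s) :
    AEMeasurable (fun ω => (G.informedSet j t' (t' + s) ω).card) μ := by
  have hu := twoTimes_mono hs
  have hu0 : twoTimes s 0 = 0 := rfl
  have hn : ∀ n : ℕ, 0 < 2 ^ n := fun n => by positivity
  refine aemeasurable_of_tendsto_metrizable_ae atTop (f := fun n ω =>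
    (countChain (gossipUpdate j) (G.meshCount (refinedMesh t' (twoTimes s) (2 ^ n))) {j}
      (2 ^ n * 1) ω).card) (fun n => ?_) ?_
  · have hT := G.poissonCounts_refinedMesh ht' hu0 hu (hn n)
    exact ((Measurable.of_discrete (f := Finset.card)).comp
      ((measurable_countChain (gossipUpdate j) {j} (2 ^ n * 1)).mono
        (hT.countPast_le _) le_rfl)).aemeasurable
  · have hsum : ∑' n, μ (G.meshFailure t' (twoTimes s) 1 (2 ^ n)) ≠ ⊤ := by
      have hle : ∀ n, μ (G.meshFailure t' (twoTimes s) 1 (2 ^ n)) ≤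
          ENNReal.ofReal ((totalRate N lamC lamR * s) ^ 2 * (1 / 2) ^ n) := by
        intro n
        rw [← ofReal_measureReal]
        refine ENNReal.ofReal_le_ofReal
          ((G.real_meshFailure_le ht' hu0 hu (hn n) 1).trans_eq ?_)
        simp [twoTimes, div_eq_mul_inv]
      refine ne_top_of_le_ne_top ?_ (ENNReal.tsum_le_tsum hle)
      rw [← ENNReal.ofReal_tsum_of_nonneg (fun n => by positivity)
        (summable_geometric_two.mul_left _)]
      exact ENNReal.ofReal_ne_top
    filter_upwards [ae_eventually_notMem hsum] with ω hω
    refine tendsto_const_nhds.congr' ?_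
    filter_upwards [hω] with n hωn
    rw [← G.informedSet_eq_of_notMem_meshFailure j ht' hu0 hu (hn n) hωn le_rfl]
    rfl

end GossipModel

end Limit

/-! ### Paths, age of information and the main theorem -/

section Main

variable {Ω : Type*} [mΩ : MeasurableSpace Ω] {μ : Measure Ω} {N : ℕ} {lamC lamR : ℝ≥0}
  {sigma : ℝ}

lemma gossipGenerator_eq (N : ℕ) (lamC lamR : ℝ≥0) :
    gossipGenerator N lamC lamR = gossipA N lamC lamR := by
  ext r c
  simp only [gossipGenerator, birthDeathGenerator, gossipA, Matrix.of_apply, gossipBirth,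
    gossipDeath, Nat.cast_add, Nat.cast_one]
  by_cases h1 : (r : ℕ) = c + 1
  · have h2 : r ≠ c := fun h => by rw [h] at h1; omega
    have h3 : ¬ ((c : ℕ) = r + 1) := by omega
    rw [if_pos h1, if_neg h2, if_neg h3, if_pos h1]
  · by_cases h2 : (c : ℕ) = r + 1
    · have h3 : r ≠ c := fun h => by rw [h] at h2; omega
      rw [if_neg h1, if_pos h2, if_neg h3, if_pos h2, h2]
      push_cast
      ring
    · by_cases h3 : r = c
      · subst h3
        rw [if_neg h1, if_neg h2, if_pos rfl, if_pos rfl]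
      · rw [if_neg h1, if_neg h2, if_neg h3, if_neg h3, if_neg h2, if_neg h1]

/-- The function `s ↦ wᵀ e^{A s} e₁`. -/
noncomputable def gossipCDF (N : ℕ) (lamC lamR : ℝ≥0) (s : ℝ) : ℝ :=
  gossipW N ⬝ᵥ (NormedSpace.exp (s • gossipA N lamC lamR)).mulVec (gossipE1 N)

lemma gossipCDF_zero (N : ℕ) (lamC lamR : ℝ≥0) : gossipCDF N lamC lamR 0 = 0 := by
  rw [gossipCDF, zero_smul, NormedSpace.exp_zero, Matrix.one_mulVec, dotProduct]
  refine Finset.sum_eq_zero fun k _ => ?_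
  by_cases h : (k : ℕ) = 0 <;> simp [gossipW, gossipE1, h]

lemma hasDerivAt_gossipCDF (N : ℕ) (lamC lamR : ℝ≥0) (s : ℝ) :
    HasDerivAt (gossipCDF N lamC lamR) (gossipDensity N lamC lamR s) s := by
  have h := hasDerivAt_exp_smul (gossipA N lamC lamR) s
  have h' : ∀ k c, HasDerivAt (fun s : ℝ => NormedSpace.exp (s • gossipA N lamC lamR) k c)
      ((gossipA N lamC lamR * NormedSpace.exp (s • gossipA N lamC lamR)) k c) s :=
    fun k c => hasDerivAt_pi.1 (hasDerivAt_pi.1 h k) c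
  have h2 : HasDerivAt (fun s : ℝ => ∑ k, gossipW N k *
      ∑ c, NormedSpace.exp (s • gossipA N lamC lamR) k c * gossipE1 N c)
      (∑ k, gossipW N k *
        ∑ c, (gossipA N lamC lamR * NormedSpace.exp (s • gossipA N lamC lamR)) k c *
          gossipE1 N c) s :=
    HasDerivAt.fun_sum fun k _ => HasDerivAt.const_mul _
      (HasDerivAt.fun_sum fun c _ => (h' k c).mul_const _)
  exact h2

lemma continuous_gossipCDF (N : ℕ) (lamC lamR : ℝ≥0) : Continuous (gossipCDF N lamC lamR) :=
  continuous_iff_continuousAt.2 fun s => (hasDerivAt_gossipCDF N lamC lamR s).continuousAt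

lemma continuous_gossipDensity (N : ℕ) (lamC lamR : ℝ≥0) :
    Continuous (gossipDensity N lamC lamR) := by
  have h : Continuous fun s : ℝ => NormedSpace.exp (s • gossipA N lamC lamR) :=
    continuous_pi fun k => continuous_pi fun c => continuous_iff_continuousAt.2 fun s =>
      (hasDerivAt_pi.1 (hasDerivAt_pi.1 (hasDerivAt_exp_smul (gossipA N lamC lamR) s) k)
        c).continuousAt
  unfold gossipDensity
  fun_prop

namespace GossipModel

variable (G : GossipModel μ N lamC lamR sigma)

/-- Around every time there is a neighbourhood without ticks at other times. -/
lemma exists_isolating_radius (ω : Ω) (t : ℝ) :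
    ∃ δ > 0, ∀ c r, |r - t| < δ → r ∈ G.ticks c ω → r = t := by
  have hfin : (⋃ c, (G.ticks c ω ∩ Iic (t + 1))).Finite :=
    Set.finite_iUnion fun c => (G.poisson c).locallyFinite ω (t + 1)
  have hnhds := (hfin.subset Set.sdiff_subset : (_ \ {t} : Set ℝ).Finite).isClosed.isOpen_compl
    |>.mem_nhds (show t ∈ ((⋃ c, (G.ticks c ω ∩ Iic (t + 1))) \ {t})ᶜ by simp)
  obtain ⟨δ, hδ, hball⟩ := Metric.mem_nhds_iff.1 hnhds
  -- The bound `1` keeps `r` below `t + 1`, where finiteness of the ticks is available.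
  refine ⟨min δ 1, lt_min hδ one_pos, fun c r hr hrc => ?_⟩
  by_contra hne
  refine hball (Metric.mem_ball.2 (hr.trans_le (min_le_left _ _)))
    ⟨Set.mem_iUnion.2 ⟨c, hrc, ?_⟩, hne⟩
  have := (abs_lt.1 (hr.trans_le (min_le_right _ _))).2
  simp only [Set.mem_Iic]
  linarith

lemma numInformed_rightContinuous (j : Fin N) {t' : ℝ} (ht' : 0 ≤ t') (ω : Ω) {u : ℝ}
    (hu : 0 ≤ u) :
    ContinuousWithinAt (fun v => numInformed (G.events ω) j (t' + v) t') (Ici u) u := by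
  obtain ⟨δ, hδ, h⟩ := G.exists_isolating_radius ω (t' + u)
  refine tendsto_const_nhds.congr' ?_
  filter_upwards [Ico_mem_nhdsGE (show u < u + δ by linarith)] with v hv
  simp only [numInformed_eq]
  rw [G.informedSet_eq_of_no_tick j (a := t' + u) (b := t' + v) (by linarith)
    (by linarith [hv.1])]
  intro c r hr hrc
  have := h c r (by rw [abs_lt]; constructor <;> linarith [hr.1, hr.2, hv.2]) hrc
  exact hr.1.ne' this

lemma numInformed_leftLimits (j : Fin N) {t' : ℝ} (ht' : 0 ≤ t') (ω : Ω) {u : ℝ} (hu : 0 < u) :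
    ∃ k : ℕ, Tendsto (fun v => numInformed (G.events ω) j (t' + v) t') (𝓝[<] u) (𝓝 k) := by
  obtain ⟨δ, hδ, h⟩ := G.exists_isolating_radius ω (t' + u)
  have hm : 0 < min δ u := lt_min hδ hu
  have h1 : min δ u ≤ δ := min_le_left _ _
  have h2 : min δ u ≤ u := min_le_right _ _
  -- The count is constant on an interval to the left of `u`; the minimum with `u` keeps the
  -- sampling time after `t'`.
  refine ⟨numInformed (G.events ω) j (t' + (u - min δ u / 2)) t',
    tendsto_const_nhds.congr' ?_⟩
  filter_upwards [Ioo_mem_nhdsLT (show u - min δ u / 2 < u by linarith)] with v hv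
  simp only [numInformed_eq]
  rw [G.informedSet_eq_of_no_tick j (a := t' + (u - min δ u / 2)) (b := t' + v) (by linarith)
    (by linarith [hv.1])]
  intro c r hr hrc
  have := h c r (by rw [abs_lt]; constructor <;> linarith [hr.1, hr.2, hv.2]) hrc
  linarith [hr.2, hv.2]

/-- The number of informed agents is a birth–death chain. -/
lemma isBirthDeathChain_numInformed [IsProbabilityMeasure μ] (j : Fin N) {t' : ℝ}
    (ht' : 0 ≤ t') :
    IsBirthDeathChain μ (fun u ω => numInformed (G.events ω) j (t' + u) t') N 1
      (gossipBirth N lamC) (gossipDeath lamR) where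
  aemeasurable u hu := by
    simp only [numInformed_eq]
    exact G.aemeasurable_card_informedSet j ht' hu
  rightContinuous := ae_of_all _ fun ω _ hu => G.numInformed_rightContinuous j ht' ω hu
  leftLimits := ae_of_all _ fun ω _ hu => G.numInformed_leftLimits j ht' ω hu
  finiteDim m u hu0 hu k := by
    simp only [numInformed_eq]
    exact G.real_card_informedSet j ht' hu0 hu m k

lemma ageOfInfo_le_of_informed {j i : Fin N} (hij : i ≠ j) {t s : ℝ} {ω : Ω}
    (h : i ∈ G.informedSet j (t - s) t ω) : ageOfInfo (G.events ω) j i t ≤ (s : EReal) := by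
  rcases mem_informedSet.1 h with h | ⟨τ, hτ, hk⟩
  · exact absurd h hij
  · have hmem : t - τ ∈ {s : ℝ | GossipInfo.value ((G.events ω).x j (t - s)) j (t - s) ∈
        knowledgeSet (G.events ω) i t} := by
      simpa [knowledgeSet] using hk
    exact (sInf_le (Set.mem_image_of_mem _ hmem)).trans
      (EReal.coe_le_coe_iff.2 (by linarith))

/-- The inequality must be strict, since being informed requires an information strictly more recent
than `t - s`. -/
lemma informed_of_ageOfInfo_lt {j i : Fin N} {t s : ℝ} {ω : Ω}
    (h : ageOfInfo (G.events ω) j i t < (s : EReal)) : i ∈ G.informedSet j (t - s) t ω := by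
  obtain ⟨_, ⟨a, ha, rfl⟩, has⟩ := sInf_lt_iff.1 h
  have has' : a < s := EReal.coe_lt_coe_iff.1 has
  exact mem_informedSet.2 (Or.inr ⟨t - a, by linarith, ha⟩)

lemma informed_of_ageOfInfo_ne_top {j i : Fin N} (hij : i ≠ j) {t : ℝ} {ω : Ω}
    (h : ageOfInfo (G.events ω) j i t < ⊤) : i ∈ G.informedSet j 0 t ω := by
  obtain ⟨_, ⟨a, ha, rfl⟩, -⟩ := sInf_lt_iff.1 h
  exact mem_informedSet.2 (Or.inr (Knows.exists_pos (G.events_exch_pos ω) ha hij rfl))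

lemma real_informed_eq_gossipCDF [IsProbabilityMeasure μ] (hN : 2 ≤ N) {j i : Fin N}
    (hij : i ≠ j) {t s : ℝ} (hs : 0 ≤ s) (hst : s ≤ t) :
    μ.real {ω | i ∈ G.informedSet j (t - s) t ω} = gossipCDF N lamC lamR s := by
  have h := G.real_mem_informedSet hN hij (sub_nonneg.2 hst) hs
  rwa [sub_add_cancel, gossipGenerator_eq] at h

lemma pseudoCDF_eq [IsProbabilityMeasure μ] (hN : 2 ≤ N) {j i : Fin N} (hij : i ≠ j) {t s : ℝ}
    (ht : 0 ≤ t) (hs : 0 ≤ s) :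
    G.pseudoCDF j i t s = gossipCDF N lamC lamR (min s t) := by
  have hlow : ∀ s, 0 ≤ s → s ≤ t → gossipCDF N lamC lamR s ≤ G.pseudoCDF j i t s := by
    intro s hs hst
    rw [← G.real_informed_eq_gossipCDF hN hij hs hst]
    exact measureReal_mono fun ω hω => G.ageOfInfo_le_of_informed hij hω
  rcases lt_or_ge s t with hst | hts
  · rw [min_eq_left hst.le]
    refine le_antisymm ?_ (hlow s hs hst.le)
    -- For `s' > s`, age at most `s` implies being informed since `t - s'`; letting `s'` decrease to
    -- `s` closes the gap between strict and weak inequality.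
    refine ge_of_tendsto ((continuous_gossipCDF N lamC lamR).continuousWithinAt (s := Ioi s)) ?_
    filter_upwards [Ioc_mem_nhdsGT hst] with s' hs'
    rw [← G.real_informed_eq_gossipCDF hN hij (hs.trans hs'.1.le) hs'.2]
    exact measureReal_mono fun ω hω => G.informed_of_ageOfInfo_lt
      (lt_of_le_of_lt hω (EReal.coe_lt_coe_iff.2 hs'.1))
  · rw [min_eq_right hts]
    refine le_antisymm ?_ ((hlow t ht le_rfl).trans (measureReal_mono fun ω hω =>
      le_trans (show ageOfInfo (G.events ω) j i t ≤ t from hω) (EReal.coe_le_coe_iff.2 hts)))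
    -- A finite age already implies an information obtained after time `0`, so no mass is added
    -- beyond `t`.
    rw [← G.real_informed_eq_gossipCDF hN hij ht le_rfl, sub_self]
    exact measureReal_mono fun ω hω => G.informed_of_ageOfInfo_ne_top hij
      (lt_of_le_of_lt hω (EReal.coe_lt_top s))

end GossipModel

end Main

/-- In the Gossip model, for `i ≠ j`, the age at time `t` of the most recent information about `j`
held by `i` admits on `[0, t]` the pseudo-PDF `s ↦ wᵀ A e^{A s} e₁` (and no mass beyond `t`), and for
each `t' ≥ 0` the number of agents holding information about `j` more recent than `t'` evolves after
time `t'` as the birth–death chain started at `1` with birth rates `k (N - k) lamC / (N - 1)` and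
death rates `(k - 1) lamR`. -/
theorem mainTheorem5 {Ω : Type*} [MeasurableSpace Ω] (μ : Measure Ω) [IsProbabilityMeasure μ]
    (N : ℕ) (hN : 2 ≤ N) (lamC lamR : ℝ≥0) (sigma : ℝ)
    (G : GossipModel μ N lamC lamR sigma) (j : Fin N) :
    (∀ i : Fin N, i ≠ j → ∀ t : ℝ, 0 ≤ t →
      (∀ s ∈ Icc 0 t,
        HasDerivWithinAt (G.pseudoCDF j i t) (gossipDensity N lamC lamR s) (Icc 0 t) s) ∧
      (∀ s : ℝ, 0 ≤ s →
        G.pseudoCDF j i t s = ∫ r in (0 : ℝ)..min s t, gossipDensity N lamC lamR r)) ∧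
    (∀ t' : ℝ, 0 ≤ t' →
      IsBirthDeathChain μ (fun u ω => numInformed (G.events ω) j (t' + u) t') N 1
        (gossipBirth N lamC) (gossipDeath lamR)) := by
  refine ⟨fun i hij t ht => ⟨fun s hs => ?_, fun s hs => ?_⟩,
    fun t' ht' => G.isBirthDeathChain_numInformed j ht'⟩
  · refine ((hasDerivAt_gossipCDF N lamC lamR s).hasDerivWithinAt).congr (fun r hr => ?_) ?_
    · rw [G.pseudoCDF_eq hN hij ht hr.1, min_eq_left hr.2]
    · rw [G.pseudoCDF_eq hN hij ht hs.1, min_eq_left hs.2]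
  · rw [G.pseudoCDF_eq hN hij ht hs, intervalIntegral.integral_eq_sub_of_hasDerivAt
      (fun r _ => hasDerivAt_gossipCDF N lamC lamR r)
      ((continuous_gossipDensity N lamC lamR).intervalIntegrable _ _), gossipCDF_zero, sub_zero]
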